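/- Conventions. Let $R$ be a unital ring. A Galois $R$-bimodule of rank $d\ge 1$ is an $R$-bimodule $P$ such that $P\cong R^d$ as a left module, $P\cong R^d$ as a right module, and $P\otimes_R P\cong P^d$ as a bimodule. The center of an $R$-bimodule $P$ is the subring $\mathcal Z(P)=\{z\in R : zx=xz \text{ for all } x\in P\}$ of $R$. A bimodule is a multiple of a bimodule $Q$ if it is isomorphic, as a bimodule, to $Q^r$ for some integer $r\ge 1$. (i) Let $B=\bigoplus_{i=1}^n B_i$, where $B_i$ is a central simple algebra over a field $L_i$ of finite dimension $m_i^2$, and let $m_*=\gcd(m_1,\dots,m_n)$. Let $e_i$ be the unit of $B_i$, and for a $B$-bimodule $P$ put $P_{ij}=e_iPe_j$. Call $P$ connected if the graph with vertices $1,\dots,n$ and an edge $i\to j$ whenever $P_{ji}\neq 0$ is connected (with orientations forgotten; in particular $n\geq 1$). Let $P$ be a connected Galois $B$-bimodule (of some rank $d\geq 1$), and let $\mathcal Z=\mathcal Z(P)\subset B$. Then $\mathcal Z$ is a field; for each $i$ the projection $B\to B_i$ maps $\mathcal Z$ into $L_i$, and $[L_i:\mathcal Z]<\infty$ with respect to the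 resulting embedding $\mathcal Z\to L_i$; and $P^{m_*^2}$ is a multiple of $B\otimes_{\mathcal Z}B$. (ii) In particular, let $B$ be a central simple algebra over a field $L$ of finite dimension $m^2$, and let $P$ be a Galois $B$-bimodule. Then $\mathcal Z(P)$ is a field contained in $L$, $[L:\mathcal Z(P)]<\infty$, and $P^{m^2}$ is a multiple of $B\otimes_{\mathcal Z(P)}B$. -/

import Mathlib

open MulOpposite
open scoped TensorProduct

namespace GaloisBimodule

section BalancedTensor

/-! The tensor product `M ⊗_S N` of a right module `M` and a left module `N` over a ring `S` that
need not be commutative. Right `S`-modules are modules over `Sᵐᵒᵖ`. -/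

variable (S : Type*) [Ring S] (M : Type*) [AddCommGroup M] [Module Sᵐᵒᵖ M]
  (N : Type*) [AddCommGroup N] [Module S N]

/-- The subgroup of `M ⊗_ℤ N` generated by the elements `xs ⊗ y - x ⊗ sy`. -/
def balancedRel : AddSubgroup (M ⊗[ℤ] N) :=
  AddSubgroup.closure {t | ∃ (x : M) (s : S) (y : N), t = (op s • x) ⊗ₜ[ℤ] y - x ⊗ₜ[ℤ] (s • y)}

/-- The balanced tensor product `M ⊗_S N`, an abelian group. -/
def BalancedTensor : Type _ := (M ⊗[ℤ] N) ⧸ balancedRel S M N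

instance : AddCommGroup (BalancedTensor S M N) :=
  inferInstanceAs (AddCommGroup ((M ⊗[ℤ] N) ⧸ balancedRel S M N))

namespace BalancedTensor

variable {M N}

/-- The pure tensor `x ⊗ y` in `M ⊗_S N`. -/
def tmul (x : M) (y : N) : BalancedTensor S M N :=
  QuotientAddGroup.mk' (balancedRel S M N) (x ⊗ₜ[ℤ] y)

variable {S}

@[ext high]
theorem end_ext {f g : AddMonoid.End (BalancedTensor S M N)}
    (h : ∀ x y, f (tmul S x y) = g (tmul S x y)) : f = g := by
  apply AddMonoidHom.ext
  intro t
  obtain ⟨t, rfl⟩ := QuotientAddGroup.mk'_surjective (balancedRel S M N) t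
  induction t with
  | zero => exact (map_zero f).trans (map_zero g).symm
  | tmul x y => exact h x y
  | add a b ha hb =>
    exact (map_add f _ _).trans ((congrArg₂ (· + ·) ha hb).trans (map_add g _ _).symm)

theorem add_tmul (x x' : M) (y : N) : tmul S (x + x') y = tmul S x y + tmul S x' y :=
  congrArg (QuotientAddGroup.mk' (balancedRel S M N)) (TensorProduct.add_tmul x x' y)

theorem tmul_add (x : M) (y y' : N) : tmul S x (y + y') = tmul S x y + tmul S x y' :=
  congrArg (QuotientAddGroup.mk' (balancedRel S M N)) (TensorProduct.tmul_add x y y')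

theorem zero_tmul (y : N) : tmul S (0 : M) y = 0 :=
  congrArg (QuotientAddGroup.mk' (balancedRel S M N)) (TensorProduct.zero_tmul M y)

theorem tmul_zero (x : M) : tmul S x (0 : N) = 0 :=
  congrArg (QuotientAddGroup.mk' (balancedRel S M N)) (TensorProduct.tmul_zero N x)

theorem smul_tmul (s : S) (x : M) (y : N) : tmul S (op s • x) y = tmul S x (s • y) :=
  QuotientAddGroup.eq_iff_sub_mem.2 (AddSubgroup.subset_closure ⟨x, s, y, rfl⟩)

/-- The endomorphism `f ⊗ g` of `M ⊗_S N`, for `S`-linear `f` and `g`. -/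
def mapEnd (f : M →ₗ[Sᵐᵒᵖ] M) (g : N →ₗ[S] N) : AddMonoid.End (BalancedTensor S M N) :=
  QuotientAddGroup.map (balancedRel S M N) (balancedRel S M N)
    (TensorProduct.map f.toAddMonoidHom.toIntLinearMap
      g.toAddMonoidHom.toIntLinearMap).toAddMonoidHom (by
      refine (AddSubgroup.closure_le _).2 ?_
      rintro _ ⟨x, s, y, rfl⟩
      refine AddSubgroup.subset_closure ⟨f x, s, g y, ?_⟩
      simp)

@[simp]
theorem mapEnd_tmul (f : M →ₗ[Sᵐᵒᵖ] M) (g : N →ₗ[S] N) (x : M) (y : N) :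
    mapEnd f g (tmul S x y) = tmul S (f x) (g y) := rfl

/-- `M ⊗_S N` is a left `A`-module when `M` is an `(A, S)`-bimodule: `a(x ⊗ y) = ax ⊗ y`. -/
instance leftModule {A : Type*} [Ring A] [Module A M] [SMulCommClass A Sᵐᵒᵖ M] :
    Module A (BalancedTensor S M N) :=
  Module.compHom _
    ({ toFun := fun a => mapEnd (Module.toModuleEnd Sᵐᵒᵖ (S := A) M a) LinearMap.id
       map_one' := by ext; simp
       map_mul' := fun a b => by ext; simp [mul_smul]
       map_zero' := by ext; simp [zero_tmul]
       map_add' := fun a b => by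
        ext x y
        exact (congrArg (fun v => tmul S v y) (add_smul a b x)).trans (add_tmul _ _ y) } :
      A →+* AddMonoid.End (BalancedTensor S M N))

/-- `M ⊗_S N` is a right `C`-module when `N` is an `(S, C)`-bimodule: `(x ⊗ y)c = x ⊗ yc`. -/
instance rightModule {C : Type*} [Ring C] [Module Cᵐᵒᵖ N] [SMulCommClass S Cᵐᵒᵖ N] :
    Module Cᵐᵒᵖ (BalancedTensor S M N) :=
  haveI : SMulCommClass Cᵐᵒᵖ S N := SMulCommClass.symm S Cᵐᵒᵖ N
  Module.compHom _
    ({ toFun := fun c => mapEnd LinearMap.id (Module.toModuleEnd S (S := Cᵐᵒᵖ) N c)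
       map_one' := by ext; simp
       map_mul' := fun a b => by ext; simp [mul_smul]
       map_zero' := by ext; simp [tmul_zero]
       map_add' := fun a b => by
        ext x y
        exact (congrArg (tmul S x) (add_smul a b y)).trans (tmul_add x _ _) } :
      Cᵐᵒᵖ →+* AddMonoid.End (BalancedTensor S M N))

theorem smul_left_tmul {A : Type*} [Ring A] [Module A M] [SMulCommClass A Sᵐᵒᵖ M]
    (a : A) (x : M) (y : N) : a • tmul S x y = tmul S (a • x) y := rfl

theorem smul_right_tmul {C : Type*} [Ring C] [Module Cᵐᵒᵖ N] [SMulCommClass S Cᵐᵒᵖ N]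
    (c : C) (x : M) (y : N) : op c • tmul S x y = tmul S x (op c • y) := rfl

end BalancedTensor

end BalancedTensor

/-- A subring `Z` of `R` acts on `R` by right multiplication. -/
instance subringRightModule {R : Type*} [Ring R] (Z : Subring R) : Module (↥Z)ᵐᵒᵖ R :=
  Module.compHom R (RingHom.op Z.subtype)

theorem subring_op_smul {R : Type*} [Ring R] (Z : Subring R) (z : Z) (x : R) :
    op z • x = x * (z : R) := rfl

instance subring_smulCommClass_right {R : Type*} [Ring R] (Z : Subring R) :
    SMulCommClass R (↥Z)ᵐᵒᵖ R :=
  ⟨fun a z x => (mul_assoc a x ((unop z : Z) : R)).symm⟩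

instance subring_smulCommClass_left {R : Type*} [Ring R] (Z : Subring R) :
    SMulCommClass (↥Z) Rᵐᵒᵖ R :=
  ⟨fun z a x => (mul_assoc (z : R) x (unop a)).symm⟩

/-- Isomorphism of `R`-bimodules: a left linear bijection that is also right linear. -/
def BimoduleIso (R : Type*) [Ring R] (P Q : Type*) [AddCommGroup P] [AddCommGroup Q]
    [Module R P] [Module Rᵐᵒᵖ P] [Module R Q] [Module Rᵐᵒᵖ Q] : Prop :=
  ∃ e : P ≃ₗ[R] Q, ∀ (r : R) (x : P), e (op r • x) = op r • e x

section Bimodule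

variable (R : Type*) [Ring R] (P : Type*) [AddCommGroup P] [Module R P] [Module Rᵐᵒᵖ P]
  [SMulCommClass R Rᵐᵒᵖ P]

/-- The center `{z ∈ R : zx = xz for all x ∈ P}` of an `R`-bimodule `P`. -/
def bimoduleCenter : Subring R where
  carrier := {z | ∀ x : P, z • x = op z • x}
  mul_mem' {z w} hz hw x := by
    rw [mul_smul, hw, smul_comm, hz, op_mul, mul_smul]
  one_mem' x := by simp
  add_mem' {z w} hz hw x := by
    rw [add_smul, hz, hw, op_add, add_smul]
  zero_mem' x := by simp
  neg_mem' {z} hz x := by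
    rw [neg_smul, hz, op_neg, neg_smul]

/-- `P` is a Galois bimodule of rank `d ≥ 1` over `R`: it is isomorphic to `R ^ d` as a left and
as a right module, and `P ⊗_R P ≅ P ^ d` as bimodules. -/
structure IsGalois (d : ℕ) : Prop where
  one_le : 1 ≤ d
  free_left : Nonempty (P ≃ₗ[R] (Fin d → R))
  free_right : Nonempty (P ≃ₗ[Rᵐᵒᵖ] (Fin d → R))
  tensor : BimoduleIso R (BalancedTensor R P P) (Fin d → P)

end Bimodule

section Product

variable {ι : Type*} [DecidableEq ι] (B : ι → Type*) [∀ i, Ring (B i)]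
  (P : Type*) [AddCommGroup P] [Module (∀ i, B i) P] [Module (∀ i, B i)ᵐᵒᵖ P]
  [SMulCommClass (∀ i, B i) (∀ i, B i)ᵐᵒᵖ P]

/-- The `(B i, B j)`-component `e_i P e_j` of a bimodule `P` over the product of the rings `B i`,
where `e_i` is the unit of `B i`. -/
def component (i j : ι) : Set P :=
  {p | ∃ x : P, p = (Pi.single i 1 : ∀ i, B i) • op (Pi.single j 1 : ∀ i, B i) • x}

/-- The oriented incidence graph of `P`: there is an edge `i → j` when `P_{ji} ≠ 0`. -/
def incidenceGraph : Digraph ι where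
  Adj i j := component B P j i ≠ {0}

/-- `P` is connected: its incidence graph, with orientations forgotten, is connected. -/
def IsConnectedBimodule : Prop :=
  (SimpleGraph.fromRel (incidenceGraph B P).Adj).Connected

end Product

/-- `L` is a finite module over `Z` through the ring homomorphism `ψ : Z → L`. -/
def FiniteVia {Z L : Type*} [Ring Z] [Field L] (ψ : Z →+* L) : Prop :=
  letI : Module Z L := Module.compHom L ψ
  Module.Finite Z L

end GaloisBimodule

/-! Let `R` be the base ring, K = Z(P), N = [R : K], C = R ⊗_K R and E = R ⊗_K Rᵒᵖ.

Coefficients. A left functional φ and p ∈ P give the coefficient b ↦ φ(pb) on R. The isomorphism P ⊗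
P ≅ P^d makes the span of the coefficients closed under composition (`coeff_comp_coeff_mem`);
together with the two-sided multiplications they form an artinian ring acting on R. Its submodules
of R are the two-sided ideals stable under coefficients. Connectedness leaves only the trivial ones:
stability controls edges in one direction, and a length count in P ⊗ P reverses them
(`IsGalois.op_smul_eq_of_smul_eq`). So R is a simple module with endomorphism ring K. Schur's lemma
makes K a field, Jacobson density makes N finite, and the double centralizer theorem with an ideal
argument shows that the coefficients span End_K(R) (`IsGalois.mem_coeffSpan`). Since End_K(R) = R ⊗
R^* and R^* is a generator for semisimple R, P is a generator over E (`bimodRank_pos`).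

Proportionality. E need not be semisimple, because the centres L_i may be inseparable over K.
Ordinary multiplicities are therefore replaced by a_S(X), the multiplicity in X of the projective
cover of a simple S. It is additive, and a finitely generated projective Y is a summand of X as soon
as a_S(Y) ≤ a_S(X) for all S (`exists_equiv_prod_of_projRank_le`). Choose S minimizing
a_S(P)/a_S(C). Then a_S(C) copies of P are a_S(P) copies of C plus some Y. Since C ⊗ P and P ⊗ C are
C^d and C ⊗ C is C^N, the bound a_S(Y ⊗ Y) ≥ 0 says that the minimal ratio is at least d/N. Hence
C^d is a summand of P^N, and equal left ranks give P^N ≅ C^d; thus N a_S(P) = d a_S(C) for all S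
(`finrank_mul_bimodRank`).

Exponent. So N divides every d a_S(C). For S supported on the factors B_i and B_jᵒᵖ, a_S(C) is the
dimension of S over its endomorphism ring, and its square divides m_i² m_j² (`IsFactor.exists_dvd`).
Taking gcds, N divides d m_*², and r = d m_*² / N copies of C give the m_*²-th power of P. -/

namespace GaloisBimodule

/-! ### Multiplicities of projective covers. -/

section ProjectiveRank

variable (E : Type*) [Ring E] (S : Type*) [AddCommGroup S] [Module E S]
  (X : Type*) [AddCommGroup X] [Module E X] (Y : Type*) [AddCommGroup Y] [Module E Y]

/-- The linear maps `X → S` that are sums of maps factoring through the regular module. -/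
def projHom : Submodule (Module.End E S) (X →ₗ[E] S) :=
  Submodule.span _ {h | ∃ (f : X →ₗ[E] E) (g : E →ₗ[E] S), h = g ∘ₗ f}

/-- The rank of `projHom E S X` over the endomorphism ring of `S`. For simple `S` this is the
multiplicity of the projective cover of `S` as a direct summand of `X`. -/
noncomputable def projRank : ℕ := Module.finrank (Module.End E S) (projHom E S X)

variable {X Y}

/-- Precomposition with a linear map, as a linear map over the endomorphism ring. -/
def precomp (h : X →ₗ[E] Y) : (Y →ₗ[E] S) →ₗ[Module.End E S] (X →ₗ[E] S) where
  toFun f := f ∘ₗ h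
  map_add' _ _ := rfl
  map_smul' _ _ := rfl

theorem precomp_mem_projHom (h : X →ₗ[E] Y) {f : Y →ₗ[E] S} (hf : f ∈ projHom E S Y) :
    f ∘ₗ h ∈ projHom E S X := by
  suffices H : projHom E S Y ≤ (projHom E S X).comap (precomp E S h) from H hf
  refine Submodule.span_le.2 ?_
  rintro _ ⟨f, g, rfl⟩
  exact Submodule.subset_span ⟨f ∘ₗ h, g, rfl⟩

theorem projRank_congr (e : X ≃ₗ[E] Y) : projRank E S X = projRank E S Y :=
  LinearEquiv.finrank_eq
    { toFun := fun f => ⟨f.1 ∘ₗ e.symm.toLinearMap, precomp_mem_projHom E S _ f.2⟩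
      invFun := fun f => ⟨f.1 ∘ₗ e.toLinearMap, precomp_mem_projHom E S _ f.2⟩
      map_add' := fun _ _ => rfl
      map_smul' := fun _ _ => rfl
      left_inv := fun f => Subtype.ext (LinearMap.ext fun x => by simp)
      right_inv := fun f => Subtype.ext (LinearMap.ext fun x => by simp) }

/-- `projHom` is additive. -/
def projHomProd : projHom E S (X × Y) ≃ₗ[Module.End E S] projHom E S X × projHom E S Y where
  toFun f := ⟨⟨f.1 ∘ₗ LinearMap.inl E X Y, precomp_mem_projHom E S _ f.2⟩,
    ⟨f.1 ∘ₗ LinearMap.inr E X Y, precomp_mem_projHom E S _ f.2⟩⟩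
  invFun f := ⟨f.1.1 ∘ₗ LinearMap.fst E X Y + f.2.1 ∘ₗ LinearMap.snd E X Y,
    add_mem (precomp_mem_projHom E S _ f.1.2) (precomp_mem_projHom E S _ f.2.2)⟩
  map_add' _ _ := rfl
  map_smul' _ _ := rfl
  left_inv f := Subtype.ext (LinearMap.ext fun x => by
    simp [← map_add])
  right_inv f := by
    refine Prod.ext (Subtype.ext (LinearMap.ext fun x => ?_))
      (Subtype.ext (LinearMap.ext fun x => ?_)) <;> simp

theorem projHom_self : projHom E S E = ⊤ :=
  eq_top_iff.2 fun f _ => Submodule.subset_span ⟨LinearMap.id, f, rfl⟩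

/-- Every map out of `E` factors through `E`, and evaluation at 1 identifies these maps with `S`.
This is the dimension whose square is bounded in `IsFactor.exists_dvd`. -/
theorem projRank_self : projRank E S E = Module.finrank (Module.End E S) S := by
  rw [projRank, projHom_self, finrank_top]
  exact (LinearMap.ringLmapEquivSelf E (Module.End E S) S).finrank_eq

theorem projRank_of_subsingleton [IsSimpleModule E S] [Subsingleton X] : projRank E S X = 0 := by
  have : Subsingleton (projHom E S X) := ⟨fun f g => Subtype.ext (LinearMap.ext fun x => by
    rw [Subsingleton.elim x 0, map_zero, map_zero])⟩
  have := IsSimpleModule.nontrivial E S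
  exact Module.finrank_zero_of_subsingleton

section Simple

variable [IsSimpleModule E S]

/-- By Jacobson density one scalar moves independent vectors to arbitrary targets, so `E` surjects
onto a power of `S` of length `s.card`. This bounds the dimension of `S` uniformly in `S`. -/
theorem card_le_length (s : Finset S)
    (hs : LinearIndependent (Module.End E S) fun i : s => (i : S)) :
    (s.card : ℕ∞) ≤ Module.length E E := by
  classical
  let φ : E →ₗ[E] (s → S) := LinearMap.pi fun x => LinearMap.toSpanSingleton E S x.1
  have hφ : Function.Surjective φ := by
    intro y
    -- The left inverse extends the prescribed values `y` to an endomorphism of `S`, which density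
    -- realizes on `s` by a scalar.
    obtain ⟨g, hg⟩ := LinearMap.exists_leftInverse_of_injective
      (Finsupp.linearCombination (Module.End E S) fun i : s => (i : S))
      (LinearMap.ker_eq_bot.2 hs)
    obtain ⟨r, hr⟩ := jacobson_density
      ((Finsupp.linearCombination (Module.End E S) y) ∘ₗ g) s
    refine ⟨r, funext fun x => ?_⟩
    have h1 := LinearMap.congr_fun hg (Finsupp.single x 1)
    simp only [LinearMap.comp_apply, Finsupp.linearCombination_single, one_smul,
      LinearMap.id_apply] at h1
    have h2 := hr x.1 x.2
    rw [LinearMap.comp_apply, h1, Finsupp.linearCombination_single, one_smul] at h2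
    simp [φ, h2]
  calc (s.card : ℕ∞) = Module.length E (s → S) := by
        rw [Module.length_pi_of_fintype]
        simp [Module.length_eq_one]
    _ ≤ _ := Module.length_le_of_surjective φ hφ

theorem exists_comp_ne_zero (h : 0 < projRank E S X) :
    ∃ (f : X →ₗ[E] E) (g : E →ₗ[E] S), g ∘ₗ f ≠ 0 := by
  by_contra! H
  have : projHom E S X = ⊥ := by
    refine Submodule.span_eq_bot.2 ?_
    rintro _ ⟨f, g, rfl⟩
    exact H f g
  rw [projRank, this] at h
  have := IsSimpleModule.nontrivial E S
  simp at h

variable [IsArtinianRing E]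

theorem rank_le_length :
    Module.rank (Module.End E S) S ≤ ((Module.length E E).toNat : Cardinal) := by
  refine rank_le fun s hs => ?_
  have := card_le_length E S s hs
  rw [← ENat.natCast_toNat (Module.length_ne_top (R := E) (M := E))] at this
  exact_mod_cast this

theorem finite_end_of_isSimpleModule : Module.Finite (Module.End E S) S := by
  classical
  exact Module.rank_lt_aleph0_iff.1 ((rank_le_length E S).trans_lt (Cardinal.natCast_lt_aleph0))

/-- The multiplicities `projRank E S E` are bounded independently of `S`. -/
theorem projRank_self_le : projRank E S E ≤ (Module.length E E).toNat := by
  rw [projRank_self]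
  exact Module.finrank_le_of_rank_le (rank_le_length E S)

theorem projRank_self_pos : 0 < projRank E S E := by
  classical
  have := finite_end_of_isSimpleModule E S
  have := IsSimpleModule.nontrivial E S
  rw [projRank_self]
  exact Module.finrank_pos

theorem finite_linearMap [Module.Finite E X] : Module.Finite (Module.End E S) (X →ₗ[E] S) := by
  classical
  have := finite_end_of_isSimpleModule E S
  obtain ⟨n, f, hf⟩ := Module.Finite.exists_fin' E X
  let φ : (X →ₗ[E] S) →ₗ[Module.End E S] (Fin n → S) :=
    { toFun := fun h i => h (f (Pi.single i 1))
      map_add' := fun _ _ => rfl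
      map_smul' := fun _ _ => rfl }
  refine Module.Finite.of_injective φ fun g h hgh => ?_
  have : g ∘ₗ f = h ∘ₗ f := LinearMap.pi_ext' fun i => LinearMap.ext_ring (congrFun hgh i)
  ext x
  obtain ⟨x, rfl⟩ := hf x
  exact LinearMap.congr_fun this x

theorem finite_projHom [Module.Finite E X] : Module.Finite (Module.End E S) (projHom E S X) := by
  classical
  have := finite_linearMap E S (X := X)
  infer_instance

theorem projRank_prod [Module.Finite E X] [Module.Finite E Y] :
    projRank E S (X × Y) = projRank E S X + projRank E S Y := by
  classical
  have := finite_projHom E S (X := X)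
  have := finite_projHom E S (X := Y)
  rw [projRank, (projHomProd E S).finrank_eq, Module.finrank_prod]
  rfl

theorem projRank_pi [Module.Finite E X] (n : ℕ) :
    projRank E S (Fin n → X) = n * projRank E S X := by
  induction n with
  | zero => rw [projRank_of_subsingleton, zero_mul]
  | succ n ih =>
    rw [← projRank_congr E S (Fin.consLinearEquiv E fun _ : Fin (n + 1) => X), projRank_prod, ih,
      add_mul, one_mul, add_comm]

theorem projRank_pos [Module.Finite E X] (f : X →ₗ[E] E) (g : E →ₗ[E] S) (h : g ∘ₗ f ≠ 0) :
    0 < projRank E S X := by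
  classical
  have := finite_projHom E S (X := X)
  have : Nontrivial (projHom E S X) :=
    ⟨⟨g ∘ₗ f, Submodule.subset_span ⟨f, g, rfl⟩⟩, 0, fun h' => h (congrArg Subtype.val h')⟩
  exact Module.finrank_pos

end Simple

end ProjectiveRank

/-! ### Splitting off projective summands. -/

section Summand

variable {E : Type*} [Ring E]

/-- The idempotent `i ∘ (r ∘ i)⁻¹ ∘ r` splits `X` into a copy of `Y` and the kernel of `r`. -/
theorem exists_equiv_prod_of_bijective_comp {X Y : Type*} [AddCommGroup X] [Module E X]
    [AddCommGroup Y] [Module E Y] (i : Y →ₗ[E] X) (r : X →ₗ[E] Y)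
    (h : Function.Bijective (r ∘ₗ i)) : Nonempty (X ≃ₗ[E] Y × LinearMap.ker r) := by
  let b := LinearEquiv.ofBijective (r ∘ₗ i) h
  have hb : ∀ y, r (i (b.symm y)) = y := fun y => b.apply_symm_apply y
  exact ⟨{
    toFun := fun x => (r x, ⟨x - i (b.symm (r x)), by simp [hb]⟩)
    invFun := fun p => i (b.symm p.1) + p.2
    map_add' := fun x y => by
      refine Prod.ext (map_add _ _ _) (Subtype.ext ?_)
      simp only [map_add, Prod.snd_add, Submodule.coe_add]
      abel
    map_smul' := fun c x => by
      refine Prod.ext (map_smul _ _ _) (Subtype.ext ?_)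
      simp [smul_sub]
    left_inv := fun x => by simp
    right_inv := fun p => by
      have : r p.2 = 0 := p.2.2
      refine Prod.ext ?_ (Subtype.ext ?_) <;> simp [hb, this] }⟩

/-- Fitting's lemma for `k = f ∘ g`: as `π ∘ k = π`, no power of `k` vanishes, so its stable range
`Y₁` is nonzero. It splits off from `Y`, and also from `X`, because `k ^ (n + 1)` is an automorphism
of `Y₁` factoring through `X`. -/
theorem exists_common_summand {X Y S : Type*} [AddCommGroup X] [Module E X]
    [AddCommGroup Y] [Module E Y] [AddCommGroup S] [Module E S]
    [IsNoetherian E Y] [IsArtinian E Y]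
    (f : X →ₗ[E] Y) (g : Y →ₗ[E] X) (π : Y →ₗ[E] S) (hπ : π ≠ 0) (h : π ∘ₗ f ∘ₗ g = π) :
    ∃ (Y₁ Y₂ : Submodule E Y) (X₂ : Submodule E X), Y₁ ≠ ⊥ ∧ Nonempty (Y ≃ₗ[E] Y₁ × Y₂) ∧
      Nonempty (X ≃ₗ[E] Y₁ × X₂) := by
  let k : Module.End E Y := f ∘ₗ g
  obtain ⟨n, hc, hn⟩ := ((k.eventually_isCompl_ker_pow_range_pow).and
    (Filter.eventually_ge_atTop 1)).exists
  have hk : ∀ m : ℕ, π ∘ₗ (k ^ m) = π := by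
    intro m
    induction m with
    | zero => rfl
    | succ m ih => rw [pow_succ, Module.End.mul_eq_comp, ← LinearMap.comp_assoc, ih]; exact h
  let Y₁ := LinearMap.range (k ^ n)
  let r : X →ₗ[E] Y₁ := (k ^ n).rangeRestrict ∘ₗ f
  let i : Y₁ →ₗ[E] X := g ∘ₗ Y₁.subtype
  have hi : Function.Injective (r ∘ₗ i) := by
    refine LinearMap.ker_eq_bot.1 ((Submodule.eq_bot_iff _).2 fun y hy => ?_)
    have h1 : (k ^ n) (k y) = 0 := congrArg Subtype.val hy
    have h2 : k y ∈ Y₁ := by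
      obtain ⟨z, hz⟩ := y.2
      refine ⟨k z, ?_⟩
      rw [← hz, ← Module.End.mul_apply, ← Module.End.mul_apply, ← pow_succ, ← pow_succ']
    have h3 : k y = 0 := Submodule.disjoint_def.1 hc.disjoint _ h1 h2
    refine Subtype.ext (Submodule.disjoint_def.1 hc.disjoint _ ?_ y.2)
    obtain ⟨m, rfl⟩ := Nat.exists_eq_add_of_le' hn
    rw [LinearMap.mem_ker, pow_succ, Module.End.mul_apply, h3, map_zero]
  obtain ⟨e⟩ := exists_equiv_prod_of_bijective_comp i r
    (IsArtinian.bijective_of_injective_endomorphism _ hi)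
  refine ⟨Y₁, LinearMap.ker (k ^ n), LinearMap.ker r, fun h0 => hπ ?_,
    ⟨(Submodule.prodEquivOfIsCompl _ _ hc.symm).symm⟩, ⟨e⟩⟩
  rw [← hk n, LinearMap.range_eq_bot.1 h0, LinearMap.comp_zero]

end Summand

section Summand

universe u v w

variable {E : Type u} [Ring E] [IsArtinianRing E]

/-- A finitely generated projective module is a direct summand of every finitely generated
module of larger projective rank at every simple module. -/
theorem exists_equiv_prod_of_projRank_le {Y : Type v} {X : Type w} [AddCommGroup Y] [Module E Y]
    [AddCommGroup X] [Module E X] [Module.Finite E Y] [Module.Finite E X] [Module.Projective E Y]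
    (h : ∀ I : Submodule E E, IsSimpleModule E (E ⧸ I) →
      projRank E (E ⧸ I) Y ≤ projRank E (E ⧸ I) X) :
    ∃ Q : Submodule E X, Nonempty (X ≃ₗ[E] Y × Q) := by
  obtain ⟨n, hn⟩ := ENat.ne_top_iff_exists.1 (Module.length_ne_top (R := E) (M := Y))
  induction n using Nat.strong_induction_on generalizing Y X with
  | _ n ih =>
  obtain hY | hY := subsingleton_or_nontrivial Y
  · let _ := uniqueOfSubsingleton (0 : Y)
    refine ⟨⊤, ⟨?_⟩⟩
    exact (Submodule.topEquiv.symm).trans (LinearEquiv.uniqueProd (M₂ := Y)).symm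
  obtain ⟨N, hN⟩ : ∃ N : Submodule E Y, IsCoatom N := by
    obtain h | ⟨N, hN, -⟩ := eq_top_or_exists_le_coatom (⊥ : Submodule E Y)
    · exact absurd h bot_ne_top
    · exact ⟨N, hN⟩
  have hS : IsSimpleModule E (Y ⧸ N) := isSimpleModule_iff_isCoatom.2 hN
  -- The hypothesis only tests simple quotients of `E`, which keeps it in one universe; the simple
  -- quotient of `Y` is replaced by such a model.
  obtain ⟨I, hI, ⟨e⟩⟩ := isSimpleModule_iff_quot_maximal.1 hS
  have hI' : IsSimpleModule E (E ⧸ I) := isSimpleModule_iff_isCoatom.2 hI.out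
  let π : Y →ₗ[E] E ⧸ I := e.toLinearMap ∘ₗ N.mkQ
  have hπs : Function.Surjective π := e.surjective.comp N.mkQ_surjective
  have hπ : π ≠ 0 := by
    have := IsSimpleModule.nontrivial E (E ⧸ I)
    rintro h0
    obtain ⟨y, hy⟩ := exists_ne (0 : E ⧸ I)
    obtain ⟨x, rfl⟩ := hπs y
    exact hy (by rw [h0, LinearMap.zero_apply])
  have hpos : 0 < projRank E (E ⧸ I) Y := by
    obtain ⟨s, hs⟩ := Module.projective_lifting_property
      (Submodule.mkQ I) π (Submodule.mkQ_surjective I)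
    exact projRank_pos E _ s I.mkQ (by rwa [hs])
  obtain ⟨a, b, hab⟩ := exists_comp_ne_zero E _ (hpos.trans_le (h I hI'))
  -- Lifting `b` through `π`, and then `π` through `b ∘ a`, gives maps X → Y → S and Y → X
  -- satisfying the hypothesis of `exists_common_summand`.
  obtain ⟨a', ha'⟩ := Module.projective_lifting_property π b hπs
  obtain ⟨g, hg⟩ := Module.projective_lifting_property (b ∘ₗ a) π
    (LinearMap.surjective_of_ne_zero hab)
  obtain ⟨Y₁, Y₂, X₂, hY₁, ⟨eY⟩, ⟨eX⟩⟩ := exists_common_summand (a' ∘ₗ a) g π hπ (by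
    rw [← ha'] at hg; exact hg)
  have : Module.Projective E (Y₁ × Y₂) := Module.Projective.of_equiv eY
  have : Module.Projective E Y₂ := Module.Projective.of_split (LinearMap.inr E Y₁ Y₂)
    (LinearMap.snd E Y₁ Y₂) (LinearMap.snd_comp_inr E Y₁ Y₂)
  have hlt : Module.length E Y₂ < n := by
    rw [hn, eY.length_eq, Module.length_prod]
    have : Nontrivial Y₁ := Submodule.nontrivial_iff_ne_bot.2 hY₁
    refine lt_of_eq_of_lt (zero_add _).symm ((ENat.add_lt_add_iff_right ?_).2 Module.length_pos)
    exact Module.length_ne_top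
  obtain ⟨m, hm⟩ := ENat.ne_top_iff_exists.1 (Module.length_ne_top (R := E) (M := Y₂))
  -- Additivity cancels `Y₁` from the inequalities, and `Y₂` is projective of smaller length.
  obtain ⟨Q, ⟨eQ⟩⟩ := ih m (by rw [← hm] at hlt; exact_mod_cast hlt) (Y := Y₂) (X := X₂) (by
    intro J hJ
    have h1 := h J hJ
    rw [projRank_congr _ _ eY, projRank_congr _ _ eX, projRank_prod, projRank_prod] at h1
    exact Nat.le_of_add_le_add_left h1) hm
  let e' : X ≃ₗ[E] Y × Q := eX.trans ((LinearEquiv.prodCongr (LinearEquiv.refl E Y₁) eQ).trans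
    ((LinearEquiv.prodAssoc E Y₁ Y₂ Q).symm.trans (LinearEquiv.prodCongr eY.symm
      (LinearEquiv.refl E Q))))
  let Q' : Submodule E X := LinearMap.range (e'.symm.toLinearMap ∘ₗ LinearMap.inr E Y Q)
  refine ⟨Q', ⟨e'.trans (LinearEquiv.prodCongr (LinearEquiv.refl E Y)
    (LinearEquiv.ofInjective _ ?_))⟩⟩
  exact e'.symm.injective.comp LinearMap.inr_injective

end Summand

/-! ### Balanced tensor products and isomorphisms of bimodules. -/

section BalancedTensor

namespace BalancedTensor

variable {S : Type*} [Ring S] {M M' : Type*} [AddCommGroup M] [Module Sᵐᵒᵖ M] [AddCommGroup M']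
  [Module Sᵐᵒᵖ M'] {N N' : Type*} [AddCommGroup N] [Module S N] [AddCommGroup N'] [Module S N']
  {G : Type*} [AddCommGroup G]

@[elab_as_elim]
theorem induction_on {p : BalancedTensor S M N → Prop} (t : BalancedTensor S M N) (h0 : p 0)
    (ht : ∀ x y, p (tmul S x y)) (ha : ∀ a b, p a → p b → p (a + b)) : p t := by
  obtain ⟨t, rfl⟩ := QuotientAddGroup.mk'_surjective (balancedRel S M N) t
  induction t with
  | zero => exact h0
  | tmul x y => exact ht x y
  | add a b iha ihb => exact ha _ _ iha ihb

theorem subsingleton_left [Subsingleton M] : Subsingleton (BalancedTensor S M N) := by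
  refine subsingleton_of_forall_eq 0 fun t => ?_
  induction t using induction_on with
  | h0 => rfl
  | ht x y => rw [Subsingleton.elim x 0, zero_tmul]
  | ha a b iha ihb => rw [iha, ihb, add_zero]

theorem subsingleton_right [Subsingleton N] : Subsingleton (BalancedTensor S M N) := by
  refine subsingleton_of_forall_eq 0 fun t => ?_
  induction t using induction_on with
  | h0 => rfl
  | ht x y => rw [Subsingleton.elim y 0, tmul_zero]
  | ha a b iha ihb => rw [iha, ihb, add_zero]

/-- The universal property of the balanced tensor product. -/
def lift (f : M →+ N →+ G) (h : ∀ (s : S) x y, f (op s • x) y = f x (s • y)) :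
    BalancedTensor S M N →+ G :=
  QuotientAddGroup.lift (balancedRel S M N)
    (TensorProduct.liftAddHom f fun n x y => by simp) (by
      refine (AddSubgroup.closure_le _).2 ?_
      rintro _ ⟨x, s, y, rfl⟩
      simp [h])

@[simp]
theorem lift_tmul (f : M →+ N →+ G) (h) (x : M) (y : N) : lift (S := S) f h (tmul S x y) = f x y :=
  rfl

variable (S) in
/-- The biadditive map `(x, y) ↦ x ⊗ y`. -/
def tmulHom : M →+ N →+ BalancedTensor S M N :=
  AddMonoidHom.mk' (fun x => AddMonoidHom.mk' (tmul S x) (tmul_add x))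
    fun x x' => AddMonoidHom.ext fun y => add_tmul x x' y

@[simp]
theorem tmulHom_apply (x : M) (y : N) : tmulHom S x y = tmul S x y := rfl

theorem sum_tmul {ι : Type*} (s : Finset ι) (x : ι → M) (y : N) :
    tmul S (∑ i ∈ s, x i) y = ∑ i ∈ s, tmul S (x i) y :=
  map_sum ((tmulHom S (M := M) (N := N)).flip y) x s

theorem tmul_sum {ι : Type*} (s : Finset ι) (x : M) (y : ι → N) :
    tmul S x (∑ i ∈ s, y i) = ∑ i ∈ s, tmul S x (y i) :=
  map_sum (tmulHom S (M := M) (N := N) x) y s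

/-- The tensor product of a right linear and a left linear map. -/
def map (f : M →ₗ[Sᵐᵒᵖ] M') (g : N →ₗ[S] N') : BalancedTensor S M N →+ BalancedTensor S M' N' :=
  lift (((tmulHom S).compr₂ (AddMonoidHom.id _)).comp f.toAddMonoidHom |>.compl₂ g.toAddMonoidHom)
    fun s x y => by
      change tmul S (f (op s • x)) (g y) = tmul S (f x) (g (s • y))
      rw [map_smul, map_smul, smul_tmul]

@[simp]
theorem map_tmul (f : M →ₗ[Sᵐᵒᵖ] M') (g : N →ₗ[S] N') (x : M) (y : N) :
    map f g (tmul S x y) = tmul S (f x) (g y) := rfl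

instance smulCommClass {A C : Type*} [Ring A] [Ring C] [Module A M] [SMulCommClass A Sᵐᵒᵖ M]
    [Module Cᵐᵒᵖ N] [SMulCommClass S Cᵐᵒᵖ N] : SMulCommClass A Cᵐᵒᵖ (BalancedTensor S M N) :=
  ⟨fun a c t => by
    induction t using induction_on with
    | h0 => simp
    | ht x y => rfl
    | ha s t hs ht => simp only [smul_add, hs, ht]⟩

end BalancedTensor

end BalancedTensor

section BimoduleIso

variable {R : Type*} [Ring R] {P Q T : Type*} [AddCommGroup P] [AddCommGroup Q] [AddCommGroup T]
    [Module R P] [Module Rᵐᵒᵖ P] [Module R Q] [Module Rᵐᵒᵖ Q] [Module R T] [Module Rᵐᵒᵖ T]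

theorem BimoduleIso.symm (h : BimoduleIso R P Q) : BimoduleIso R Q P := by
  obtain ⟨e, he⟩ := h
  refine ⟨e.symm, fun r x => ?_⟩
  rw [LinearEquiv.symm_apply_eq, he, e.apply_symm_apply]

theorem BimoduleIso.trans (h : BimoduleIso R P Q) (h' : BimoduleIso R Q T) :
    BimoduleIso R P T := by
  obtain ⟨e, he⟩ := h
  obtain ⟨e', he'⟩ := h'
  exact ⟨e.trans e', fun r x => by simp [he, he']⟩

theorem BimoduleIso.of_inverse (f : P →+ Q) (g : Q →+ P) (hgf : ∀ x, g (f x) = x)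
    (hfg : ∀ x, f (g x) = x) (hl : ∀ (r : R) x, f (r • x) = r • f x)
    (hr : ∀ (r : R) x, f (op r • x) = op r • f x) : BimoduleIso R P Q :=
  ⟨{ f with map_smul' := hl, invFun := g, left_inv := hgf, right_inv := hfg }, hr⟩

theorem BimoduleIso.exists_right (h : BimoduleIso R P Q) :
    ∃ e : P ≃ₗ[Rᵐᵒᵖ] Q, ∀ (r : R) (x : P), e (r • x) = r • e x := by
  obtain ⟨e, he⟩ := h
  exact ⟨{ e with map_smul' := fun r x => he (unop r) x }, fun r x => e.map_smul r x⟩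

theorem BimoduleIso.pi (n : ℕ) (h : BimoduleIso R P Q) :
    BimoduleIso R (Fin n → P) (Fin n → Q) := by
  obtain ⟨e, he⟩ := h
  exact ⟨LinearEquiv.piCongrRight fun _ => e, fun r x => funext fun i => he r (x i)⟩

theorem BimoduleIso.refl : BimoduleIso R P P := ⟨LinearEquiv.refl R P, fun _ _ => rfl⟩

theorem bimoduleIso_cons (n : ℕ) : BimoduleIso R (Fin (n + 1) → P) (P × (Fin n → P)) :=
  BimoduleIso.symm ⟨Fin.consLinearEquiv R fun _ : Fin (n + 1) => P, fun r x =>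
    (Fin.consLinearEquiv Rᵐᵒᵖ fun _ : Fin (n + 1) => P).map_smul (op r) x⟩

variable [SMulCommClass R Rᵐᵒᵖ P] [SMulCommClass R Rᵐᵒᵖ Q] [SMulCommClass R Rᵐᵒᵖ T]

theorem BimoduleIso.tensor {P' Q' : Type*} [AddCommGroup P'] [AddCommGroup Q']
    [Module R P'] [Module Rᵐᵒᵖ P'] [Module R Q'] [Module Rᵐᵒᵖ Q'] [SMulCommClass R Rᵐᵒᵖ P']
    [SMulCommClass R Rᵐᵒᵖ Q'] (h : BimoduleIso R P P') (h' : BimoduleIso R Q Q') :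
    BimoduleIso R (BalancedTensor R P Q) (BalancedTensor R P' Q') := by
  obtain ⟨e, he⟩ := h.exists_right
  obtain ⟨e', he'⟩ := h'
  refine BimoduleIso.of_inverse (BalancedTensor.map e.toLinearMap e'.toLinearMap)
    (BalancedTensor.map e.symm.toLinearMap e'.symm.toLinearMap) (fun t => ?_) (fun t => ?_)
    (fun r t => ?_) (fun r t => ?_)
  · induction t using BalancedTensor.induction_on with
    | h0 => simp
    | ht x y => simp
    | ha s t hs ht => simp only [map_add, hs, ht]
  · induction t using BalancedTensor.induction_on with
    | h0 => simp
    | ht x y => simp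
    | ha s t hs ht => simp only [map_add, hs, ht]
  · induction t using BalancedTensor.induction_on with
    | h0 => simp
    | ht x y => simp [BalancedTensor.smul_left_tmul, he]
    | ha s t hs ht => simp only [map_add, smul_add, hs, ht]
  · induction t using BalancedTensor.induction_on with
    | h0 => simp
    | ht x y => simp [BalancedTensor.smul_right_tmul, he']
    | ha s t hs ht => simp only [map_add, smul_add, hs, ht]

theorem bimoduleIso_prod_tensor :
    BimoduleIso R (BalancedTensor R (P × Q) T)
      (BalancedTensor R P T × BalancedTensor R Q T) := by
  refine BimoduleIso.of_inverse
    ((BalancedTensor.map (LinearMap.fst Rᵐᵒᵖ P Q) LinearMap.id).prod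
      (BalancedTensor.map (LinearMap.snd Rᵐᵒᵖ P Q) LinearMap.id))
    ((BalancedTensor.map (LinearMap.inl Rᵐᵒᵖ P Q) LinearMap.id).coprod
      (BalancedTensor.map (LinearMap.inr Rᵐᵒᵖ P Q) LinearMap.id))
    (fun t => ?_) (fun t => ?_) (fun r t => ?_) (fun r t => ?_)
  · induction t using BalancedTensor.induction_on with
    | h0 => simp
    | ht x y => simp [← BalancedTensor.add_tmul]
    | ha s t hs ht => simp only [map_add, hs, ht]
  · obtain ⟨s, t⟩ := t
    rw [AddMonoidHom.coprod_apply, map_add]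
    refine (congrArg₂ (· + ·) (?_ : _ = ((s, 0) : BalancedTensor R P T × BalancedTensor R Q T))
      (?_ : _ = ((0, t) : BalancedTensor R P T × BalancedTensor R Q T))).trans (by
        rw [Prod.mk_add_mk, add_zero, zero_add])
    · induction s using BalancedTensor.induction_on with
      | h0 => simp
      | ht x y => simp [BalancedTensor.zero_tmul]
      | ha s t hs ht => simp only [map_add, hs, ht, Prod.mk_add_mk, add_zero]
    · induction t using BalancedTensor.induction_on with
      | h0 => simp
      | ht x y => simp [BalancedTensor.zero_tmul]
      | ha s t hs ht => simp only [map_add, hs, ht, Prod.mk_add_mk, add_zero]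
  · induction t using BalancedTensor.induction_on with
    | h0 => simp
    | ht x y => rfl
    | ha s t hs ht => simp only [map_add, smul_add, hs, ht]
  · induction t using BalancedTensor.induction_on with
    | h0 => simp
    | ht x y => rfl
    | ha s t hs ht => simp only [map_add, smul_add, hs, ht]

theorem bimoduleIso_tensor_prod :
    BimoduleIso R (BalancedTensor R T (P × Q))
      (BalancedTensor R T P × BalancedTensor R T Q) := by
  refine BimoduleIso.of_inverse
    ((BalancedTensor.map LinearMap.id (LinearMap.fst R P Q)).prod
      (BalancedTensor.map LinearMap.id (LinearMap.snd R P Q)))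
    ((BalancedTensor.map LinearMap.id (LinearMap.inl R P Q)).coprod
      (BalancedTensor.map LinearMap.id (LinearMap.inr R P Q)))
    (fun t => ?_) (fun t => ?_) (fun r t => ?_) (fun r t => ?_)
  · induction t using BalancedTensor.induction_on with
    | h0 => simp
    | ht x y => simp [← BalancedTensor.tmul_add]
    | ha s t hs ht => simp only [map_add, hs, ht]
  · obtain ⟨s, t⟩ := t
    rw [AddMonoidHom.coprod_apply, map_add]
    refine (congrArg₂ (· + ·) (?_ : _ = ((s, 0) : BalancedTensor R T P × BalancedTensor R T Q))
      (?_ : _ = ((0, t) : BalancedTensor R T P × BalancedTensor R T Q))).trans (by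
        rw [Prod.mk_add_mk, add_zero, zero_add])
    · induction s using BalancedTensor.induction_on with
      | h0 => simp
      | ht x y => simp [BalancedTensor.tmul_zero]
      | ha s t hs ht => simp only [map_add, hs, ht, Prod.mk_add_mk, add_zero]
    · induction t using BalancedTensor.induction_on with
      | h0 => simp
      | ht x y => simp [BalancedTensor.tmul_zero]
      | ha s t hs ht => simp only [map_add, hs, ht, Prod.mk_add_mk, add_zero]
  · induction t using BalancedTensor.induction_on with
    | h0 => simp
    | ht x y => rfl
    | ha s t hs ht => simp only [map_add, smul_add, hs, ht]
  · induction t using BalancedTensor.induction_on with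
    | h0 => simp
    | ht x y => rfl
    | ha s t hs ht => simp only [map_add, smul_add, hs, ht]

theorem finite_tensor [Module.Finite R P] [Module.Finite R Q] :
    Module.Finite R (BalancedTensor R P Q) := by
  obtain ⟨n, f, hf⟩ := Module.Finite.exists_fin' R Q
  let φ : (Fin n → P) →ₗ[R] BalancedTensor R P Q :=
    { toFun := fun x => ∑ i, BalancedTensor.tmul R (x i) (f (Pi.single i 1))
      map_add' := fun x y => by
        simp only [Pi.add_apply, BalancedTensor.add_tmul, Finset.sum_add_distrib]
      map_smul' := fun r x => by
        simp [Finset.smul_sum, BalancedTensor.smul_left_tmul] }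
  refine Module.Finite.of_surjective φ fun t => ?_
  induction t using BalancedTensor.induction_on with
  | h0 => exact ⟨0, map_zero _⟩
  | ht x y =>
    obtain ⟨c, rfl⟩ := hf y
    refine ⟨fun i => op (c i) • x, ?_⟩
    change ∑ i, BalancedTensor.tmul R (op (c i) • x) (f (Pi.single i 1)) = _
    conv_rhs => rw [← Finset.univ_sum_single c, map_sum, BalancedTensor.tmul_sum]
    refine Finset.sum_congr rfl fun i _ => ?_
    rw [BalancedTensor.smul_tmul, ← map_smul, ← Pi.single_smul, smul_eq_mul, mul_one]
  | ha s t hs ht =>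
    obtain ⟨a, ha⟩ := hs
    obtain ⟨b, hb⟩ := ht
    exact ⟨a + b, by rw [map_add, ha, hb]⟩

end BimoduleIso

/-! ### Bimodules as modules over the enveloping algebra. -/

section Enveloping

variable (K : Type*) [Field K] (R : Type*) [Ring R] [Algebra K R]

/-- The enveloping algebra `R ⊗_K Rᵒᵖ`. -/
def Env : Type _ := R ⊗[K] Rᵐᵒᵖ

noncomputable instance : Ring (Env K R) := inferInstanceAs (Ring (R ⊗[K] Rᵐᵒᵖ))

noncomputable instance : Algebra K (Env K R) := inferInstanceAs (Algebra K (R ⊗[K] Rᵐᵒᵖ))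

namespace Env

/-- The inclusion of the left factor. -/
noncomputable def includeLeft : R →+* Env K R :=
  (Algebra.TensorProduct.includeLeft : R →ₐ[K] R ⊗[K] Rᵐᵒᵖ).toRingHom

/-- The inclusion of the right factor. -/
noncomputable def includeRight : Rᵐᵒᵖ →+* Env K R :=
  (Algebra.TensorProduct.includeRight : Rᵐᵒᵖ →ₐ[K] R ⊗[K] Rᵐᵒᵖ).toRingHom

/-- The element `a ⊗ b` of the enveloping algebra. -/
def mk (a b : R) : Env K R := a ⊗ₜ[K] op b

variable {K R}

theorem mk_mul_mk (a b c d : R) : mk K R a b * mk K R c d = mk K R (a * c) (d * b) :=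
  Algebra.TensorProduct.tmul_mul_tmul _ _ _ _

theorem mk_one : mk K R 1 1 = 1 := rfl

theorem mk_eq_mul (a b : R) : mk K R a b = mk K R a 1 * mk K R 1 b := by
  rw [mk_mul_mk, mul_one, mul_one]

@[elab_as_elim]
theorem induction_on {p : Env K R → Prop} (t : Env K R) (h0 : p 0)
    (ht : ∀ a b, p (mk K R a b)) (ha : ∀ s t, p s → p t → p (s + t)) : p t :=
  TensorProduct.induction_on t h0 (fun a b => ht a (unop b)) ha

end Env

section OfEnv

/-- The bimodule given by a module over the enveloping algebra. -/
def OfEnv (_K _R M : Type*) : Type _ := M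

variable (M : Type*) [AddCommGroup M] [Module (Env K R) M]

instance : AddCommGroup (OfEnv K R M) := inferInstanceAs (AddCommGroup M)

noncomputable instance : Module R (OfEnv K R M) :=
  Module.compHom M (Env.includeLeft K R)

noncomputable instance : Module Rᵐᵒᵖ (OfEnv K R M) :=
  Module.compHom M (Env.includeRight K R)

variable {M} in
/-- The identity map. -/
def OfEnv.of : M ≃+ OfEnv K R M := AddEquiv.refl M

theorem OfEnv.smul_of (r : R) (m : M) : r • of K R m = of K R (Env.mk K R r 1 • m) := rfl

theorem OfEnv.op_smul_of (r : R) (m : M) : op r • of K R m = of K R (Env.mk K R 1 r • m) := rfl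

instance : SMulCommClass R Rᵐᵒᵖ (OfEnv K R M) :=
  ⟨fun r s m => by
    obtain ⟨m, rfl⟩ := (OfEnv.of K R).surjective m
    rw [← op_unop s, OfEnv.smul_of, OfEnv.op_smul_of, OfEnv.op_smul_of, OfEnv.smul_of, smul_smul,
      smul_smul, Env.mk_mul_mk, Env.mk_mul_mk, mul_one, one_mul, mul_one, one_mul]⟩

end OfEnv

/-- `P` is a central bimodule over the field `K`: both actions of `K` on `P` agree. -/
class IsCentralOver (X : Type*) [AddCommGroup X] [Module R X] [Module Rᵐᵒᵖ X] : Prop where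
  smul_comm : ∀ (k : K) (x : X), algebraMap K R k • x = op (algebraMap K R k) • x

/-- A central bimodule as a module over the enveloping algebra. -/
def ToEnv (_K : Type*) (_R : Type*) (X : Type*) : Type _ := X

section ToEnv

variable (X : Type*) [AddCommGroup X] [Module R X] [Module Rᵐᵒᵖ X] [SMulCommClass R Rᵐᵒᵖ X]

instance : AddCommGroup (ToEnv K R X) := inferInstanceAs (AddCommGroup X)

variable {X} in
/-- The identity map. -/
def ToEnv.of : X ≃+ ToEnv K R X := AddEquiv.refl X

noncomputable instance [h : IsCentralOver K R X] : Module (Env K R) (ToEnv K R X) :=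
  letI : Module K X := Module.compHom X (algebraMap K R)
  haveI : IsScalarTower K R X := ⟨fun k r x => by
    rw [Algebra.smul_def, mul_smul]; rfl⟩
  haveI : IsScalarTower K Rᵐᵒᵖ X := ⟨fun k r x => by
    rw [← op_unop r, ← op_smul, Algebra.smul_def, Algebra.commutes, op_mul, mul_smul]
    exact (h.smul_comm k _).symm⟩
  (TensorProduct.Algebra.module : Module (R ⊗[K] Rᵐᵒᵖ) X)

theorem ToEnv.mk_smul_of [IsCentralOver K R X] (a b : R) (x : X) :
    Env.mk K R a b • of K R x = of K R (a • op b • x) := rfl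

theorem ToEnv.of_smul [IsCentralOver K R X] (r : R) (x : X) :
    of K R (r • x) = Env.mk K R r 1 • of K R x := by
  rw [mk_smul_of, op_one, one_smul]

theorem ToEnv.of_op_smul [IsCentralOver K R X] (r : R) (x : X) :
    of K R (op r • x) = Env.mk K R 1 r • of K R x := by
  rw [mk_smul_of, one_smul]

theorem ToEnv.symm_mk_smul_left [IsCentralOver K R X] (r : R) (y : ToEnv K R X) :
    (of K R).symm (Env.mk K R r 1 • y) = r • (of K R).symm y := by
  rw [AddEquiv.symm_apply_eq, of_smul, AddEquiv.apply_symm_apply]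

theorem ToEnv.symm_mk_smul_right [IsCentralOver K R X] (r : R) (y : ToEnv K R X) :
    (of K R).symm (Env.mk K R 1 r • y) = op r • (of K R).symm y := by
  rw [AddEquiv.symm_apply_eq, of_op_smul, AddEquiv.apply_symm_apply]

instance (M : Type*) [AddCommGroup M] [Module (Env K R) M] : IsCentralOver K R (OfEnv K R M) :=
  ⟨fun k m => by
    obtain ⟨m, rfl⟩ := (OfEnv.of K R).surjective m
    rw [OfEnv.smul_of, OfEnv.op_smul_of, Env.mk, Algebra.algebraMap_eq_smul_one,
      TensorProduct.smul_tmul]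
    rfl⟩

variable {K R X}

/-- A homomorphism of bimodules as a linear map over the enveloping algebra. -/
def envHom [IsCentralOver K R X] {M : Type*} [AddCommGroup M] [Module (Env K R) M] (f : X →+ M)
    (hl : ∀ (r : R) x, f (r • x) = Env.mk K R r 1 • f x)
    (hr : ∀ (r : R) x, f (op r • x) = Env.mk K R 1 r • f x) :
    ToEnv K R X →ₗ[Env K R] M where
  toFun x := f ((ToEnv.of K R).symm x)
  map_add' x y := map_add f _ _
  map_smul' t x := by
    obtain ⟨x, rfl⟩ := (ToEnv.of K R).surjective x
    induction t using Env.induction_on with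
    | h0 => simp
    | ht a b =>
      rw [ToEnv.mk_smul_of, AddEquiv.symm_apply_apply, AddEquiv.symm_apply_apply, hl, hr,
        smul_smul, Env.mk_mul_mk, mul_one, mul_one]
      rfl
    | ha s t hs ht => simp only [add_smul, map_add, hs, ht]

/-- An isomorphism of bimodules as a linear equivalence over the enveloping algebra. -/
def envEquiv [IsCentralOver K R X] {M : Type*} [AddCommGroup M] [Module (Env K R) M] (f : X ≃+ M)
    (hl : ∀ (r : R) x, f (r • x) = Env.mk K R r 1 • f x)
    (hr : ∀ (r : R) x, f (op r • x) = Env.mk K R 1 r • f x) :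
    ToEnv K R X ≃ₗ[Env K R] M :=
  { envHom f.toAddMonoidHom hl hr, (ToEnv.of K R).symm.trans f with }

variable {Y : Type*} [AddCommGroup Y] [Module R Y] [Module Rᵐᵒᵖ Y] [SMulCommClass R Rᵐᵒᵖ Y]

theorem BimoduleIso.toEnv [IsCentralOver K R X] [IsCentralOver K R Y] (h : BimoduleIso R X Y) :
    Nonempty (ToEnv K R X ≃ₗ[Env K R] ToEnv K R Y) := by
  obtain ⟨e, he⟩ := h
  exact ⟨envEquiv (e.toAddEquiv.trans (ToEnv.of K R)) (fun r x => by
    simp [ToEnv.mk_smul_of]) (fun r x => by simp [ToEnv.mk_smul_of, he])⟩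

theorem bimoduleIso_of_toEnv [IsCentralOver K R X] [IsCentralOver K R Y]
    (e : ToEnv K R X ≃ₗ[Env K R] ToEnv K R Y) : BimoduleIso R X Y :=
  BimoduleIso.of_inverse (((ToEnv.of K R).trans e.toAddEquiv).trans (ToEnv.of K R).symm)
    (((ToEnv.of K R).trans e.symm.toAddEquiv).trans (ToEnv.of K R).symm)
    (fun x => by simp) (fun x => by simp)
    (fun r x => by
      change (ToEnv.of K R).symm (e (ToEnv.of K R (r • x))) = _
      rw [ToEnv.of_smul, map_smul, ToEnv.symm_mk_smul_left]
      rfl)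
    (fun r x => by
      change (ToEnv.of K R).symm (e (ToEnv.of K R (op r • x))) = _
      rw [ToEnv.of_op_smul, map_smul, ToEnv.symm_mk_smul_right]
      rfl)

variable (K R) in
/-- `OfEnv` followed by `ToEnv` changes nothing. -/
noncomputable def toEnvOfEnv (M : Type*) [AddCommGroup M] [Module (Env K R) M] :
    ToEnv K R (OfEnv K R M) ≃ₗ[Env K R] M :=
  envEquiv (OfEnv.of K R).symm (fun _ _ => rfl) (fun _ _ => rfl)

instance [IsCentralOver K R X] [IsCentralOver K R Y] : IsCentralOver K R (X × Y) :=
  ⟨fun k x => Prod.ext (IsCentralOver.smul_comm k x.1) (IsCentralOver.smul_comm k x.2)⟩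

instance {ι : Type*} [IsCentralOver K R X] : IsCentralOver K R (ι → X) :=
  ⟨fun k x => funext fun i => IsCentralOver.smul_comm k (x i)⟩

instance [IsCentralOver K R X] [IsCentralOver K R Y] :
    IsCentralOver K R (BalancedTensor R X Y) :=
  ⟨fun k t => by
    induction t using BalancedTensor.induction_on with
    | h0 => simp
    | ht x y =>
      rw [BalancedTensor.smul_left_tmul, BalancedTensor.smul_right_tmul,
        IsCentralOver.smul_comm k x, BalancedTensor.smul_tmul, IsCentralOver.smul_comm k y]
    | ha s t hs ht => simp only [smul_add, hs, ht]⟩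

/-- `ToEnv` commutes with binary products. -/
noncomputable def toEnvProd [IsCentralOver K R X] [IsCentralOver K R Y] :
    ToEnv K R (X × Y) ≃ₗ[Env K R] ToEnv K R X × ToEnv K R Y :=
  envEquiv (AddEquiv.prodCongr (ToEnv.of K R) (ToEnv.of K R))
    (fun r x => Prod.ext (ToEnv.of_smul K R X r x.1) (ToEnv.of_smul K R Y r x.2))
    (fun r x => Prod.ext (ToEnv.of_op_smul K R X r x.1) (ToEnv.of_op_smul K R Y r x.2))

/-- `ToEnv` commutes with powers. -/
noncomputable def toEnvPi [IsCentralOver K R X] (n : ℕ) :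
    ToEnv K R (Fin n → X) ≃ₗ[Env K R] (Fin n → ToEnv K R X) :=
  envEquiv (AddEquiv.piCongrRight fun _ => ToEnv.of K R)
    (fun r x => funext fun i => ToEnv.of_smul K R X r (x i))
    (fun r x => funext fun i => ToEnv.of_op_smul K R X r (x i))

theorem finite_toEnv [IsCentralOver K R X] [Module.Finite R X] :
    Module.Finite (Env K R) (ToEnv K R X) := by
  obtain ⟨n, f, hf⟩ := Module.Finite.exists_fin' R X
  refine Module.Finite.of_surjective
    (Fintype.linearCombination (Env K R) fun i : Fin n => ToEnv.of K R (f (Pi.single i 1)))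
    fun x => ?_
  obtain ⟨c, hc⟩ := hf ((ToEnv.of K R).symm x)
  refine ⟨fun i => Env.mk K R (c i) 1, ?_⟩
  rw [← (ToEnv.of K R).apply_symm_apply x, ← hc, Fintype.linearCombination_apply]
  conv_rhs => rw [← Finset.univ_sum_single c, map_sum, map_sum]
  refine Finset.sum_congr rfl fun i _ => ?_
  rw [← ToEnv.of_smul, ← map_smul, ← Pi.single_smul,
    smul_eq_mul, mul_one]

end ToEnv

end Enveloping

/-! ### Tensoring with the regular bimodule. -/

section FreeTensor

variable {K : Type*} [Field K] {R : Type*} [Ring R] [Algebra K R]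

theorem Env.includeLeft_mul (r : R) (t : R ⊗[K] Rᵐᵒᵖ) : (r ⊗ₜ[K] (1 : Rᵐᵒᵖ)) * t = r • t := by
  induction t with
  | zero => simp
  | tmul a b => simp [TensorProduct.smul_tmul']
  | add s t hs ht => rw [mul_add, hs, ht, smul_add]

variable (K R) in
/-- The regular bimodule `R ⊗_K R` over `K`. -/
abbrev RegBimod : Type _ := OfEnv K R (Env K R)

theorem nonempty_regBimod_equiv [FiniteDimensional K R] :
    Nonempty (RegBimod K R ≃ₗ[R] (Fin (Module.finrank K R) → R)) := by
  have b : Module.Basis (Fin (Module.finrank K R)) K Rᵐᵒᵖ :=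
    (Module.finBasis K R).map (opLinearEquiv K)
  let e : R ⊗[K] Rᵐᵒᵖ ≃ₗ[R] (Fin (Module.finrank K R) → R) :=
    (Algebra.TensorProduct.basis R b).equivFun
  refine ⟨{ e with map_smul' := fun r t => ?_ }⟩
  exact (congrArg e (Env.includeLeft_mul r t)).trans (e.map_smul r t)

instance [FiniteDimensional K R] : Module.Finite R (RegBimod K R) := by
  obtain ⟨e⟩ := nonempty_regBimod_equiv (K := K) (R := R)
  exact Module.Finite.equiv e.symm

variable {X : Type*} [AddCommGroup X] [Module R X] [Module Rᵐᵒᵖ X] [SMulCommClass R Rᵐᵒᵖ X]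
  [IsCentralOver K R X]

theorem RegBimod.induction_on {p : RegBimod K R → Prop} (t : RegBimod K R) (h0 : p 0)
    (ht : ∀ a b, p (OfEnv.of K R (Env.mk K R a b))) (ha : ∀ s t, p s → p t → p (s + t)) : p t :=
  Env.induction_on t h0 ht ha

/-- The inverse of the isomorphisms below. -/
noncomputable def regBimodSum (Y : Type*) [AddCommGroup Y] [Module R Y] [Module Rᵐᵒᵖ Y]
    [SMulCommClass R Rᵐᵒᵖ Y] [IsCentralOver K R Y] {n : ℕ} (y : Fin n → Y) :
    (Fin n → RegBimod K R) →+ Y :=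
  (ToEnv.of K R).symm.toAddMonoidHom.comp
    (Fintype.linearCombination (Env K R) (fun i => ToEnv.of K R (y i))).toAddMonoidHom

theorem regBimodSum_apply (Y : Type*) [AddCommGroup Y] [Module R Y] [Module Rᵐᵒᵖ Y]
    [SMulCommClass R Rᵐᵒᵖ Y] [IsCentralOver K R Y] {n : ℕ} (y : Fin n → Y) (a b : Fin n → R) :
    regBimodSum Y y (fun i => OfEnv.of K R (Env.mk K R (a i) (b i))) =
      ∑ i, a i • op (b i) • y i := by
  change (ToEnv.of K R).symm (Fintype.linearCombination (Env K R) (fun i => ToEnv.of K R (y i))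
    (fun i => Env.mk K R (a i) (b i))) = _
  rw [Fintype.linearCombination_apply, map_sum]
  rfl

theorem regBimodSum_single (Y : Type*) [AddCommGroup Y] [Module R Y] [Module Rᵐᵒᵖ Y]
    [SMulCommClass R Rᵐᵒᵖ Y] [IsCentralOver K R Y] {n : ℕ} (y : Fin n → Y) (i : Fin n) (a b : R) :
    regBimodSum Y y (Pi.single i (OfEnv.of K R (Env.mk K R a b))) = a • op b • y i := by
  change (ToEnv.of K R).symm (Fintype.linearCombination (Env K R) (fun i => ToEnv.of K R (y i))
    (Pi.single i (Env.mk K R a b))) = _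
  rw [Fintype.linearCombination_apply_single]
  rfl

/-- The map `a ⊗ b ↦ a ⊗ (bx)_i` for a right linear map `X → R ^ n`. -/
noncomputable def rightCoord {n : ℕ} (e : X →ₗ[Rᵐᵒᵖ] (Fin n → R)) (x : X) (i : Fin n) :
    Rᵐᵒᵖ →ₗ[K] Rᵐᵒᵖ where
  toFun b := op (e (unop b • x) i)
  map_add' b c := by simp [add_smul]
  map_smul' k b := by
    rw [unop_smul, Algebra.smul_def, mul_smul, IsCentralOver.smul_comm, map_smul, Pi.smul_apply,
      op_smul_eq_mul, ← Algebra.commutes, ← Algebra.smul_def, op_smul]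
    rfl

/-- `(R ⊗_K R) ⊗_R X = R ⊗_K X`, and a right basis of `X` unrolls this into `n` copies of `R ⊗_K R`.
Centrality of `X` makes the right coordinates linear over `K`. -/
theorem bimoduleIso_regBimod_tensor {n : ℕ} (e : X ≃ₗ[Rᵐᵒᵖ] (Fin n → R)) :
    BimoduleIso R (BalancedTensor R (RegBimod K R) X) (Fin n → RegBimod K R) := by
  let φ : RegBimod K R →+ X →+ (Fin n → RegBimod K R) :=
    AddMonoidHom.mk' (fun c => AddMonoidHom.mk' (fun x i =>
      (LinearMap.lTensor R (rightCoord (K := K) e.toLinearMap x i) : R ⊗[K] Rᵐᵒᵖ → R ⊗[K] Rᵐᵒᵖ) c)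
      fun x y => funext fun i => by
        have : rightCoord (K := K) e.toLinearMap (x + y) i =
          rightCoord e.toLinearMap x i + rightCoord e.toLinearMap y i := by
          ext b
          simp [rightCoord]
        rw [this, LinearMap.lTensor_add]
        rfl) fun c c' => AddMonoidHom.ext fun x => funext fun i => map_add (LinearMap.lTensor R
          (rightCoord (K := K) e.toLinearMap x i)) c c'
  have hφ : ∀ a b x, φ (OfEnv.of K R (Env.mk K R a b)) x =
      fun i => OfEnv.of K R (Env.mk K R a (e (b • x) i)) := fun a b x => rfl
  let f : BalancedTensor R (RegBimod K R) X →+ (Fin n → RegBimod K R) :=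
    BalancedTensor.lift φ (by
      intro s c x
      induction c using RegBimod.induction_on with
      | h0 => simp
      | ht a b =>
        rw [OfEnv.op_smul_of, smul_eq_mul, Env.mk_mul_mk, one_mul, hφ, hφ, mul_smul]
      | ha s t hs ht => simp only [smul_add, map_add, AddMonoidHom.add_apply, hs, ht])
  have hf : ∀ a b x, f (BalancedTensor.tmul R (OfEnv.of K R (Env.mk K R a b)) x) =
      fun i => OfEnv.of K R (Env.mk K R a (e (b • x) i)) := hφ
  let g : (Fin n → RegBimod K R) →+ BalancedTensor R (RegBimod K R) X :=
    regBimodSum _ fun i => BalancedTensor.tmul R (OfEnv.of K R 1) (e.symm (Pi.single i 1))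
  refine BimoduleIso.of_inverse f g (fun t => ?_) (fun c => ?_) (fun r t => ?_) (fun r t => ?_)
  · induction t using BalancedTensor.induction_on with
    | h0 => simp
    | ht c x =>
      induction c using RegBimod.induction_on with
      | h0 => simp [BalancedTensor.zero_tmul]
      | ht a b =>
        rw [hf]
        refine (regBimodSum_apply _ _ (fun _ => a) _).trans ?_
        have : ∀ i, op (e (b • x) i) • e.symm (Pi.single i 1) =
            e.symm (Pi.single i (e (b • x) i)) := fun i => by
          rw [← map_smul, ← Pi.single_smul, op_smul_eq_mul, one_mul]
        simp_rw [BalancedTensor.smul_right_tmul, this, BalancedTensor.smul_left_tmul,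
          ← BalancedTensor.tmul_sum, ← map_sum, Finset.univ_sum_single, e.symm_apply_apply,
          ← BalancedTensor.smul_tmul]
        rw [OfEnv.smul_of, OfEnv.op_smul_of, smul_smul, Env.mk_mul_mk, one_mul, one_mul,
          smul_eq_mul, mul_one]
      | ha s t hs ht => simp only [BalancedTensor.add_tmul, map_add, hs, ht]
    | ha s t hs ht => simp only [map_add, hs, ht]
  · have key : ∀ i (c : RegBimod K R), f (g (Pi.single i c)) = Pi.single i c := fun i c => by
      induction c using RegBimod.induction_on with
      | h0 => simp
      | ht a b =>
        refine (congrArg f (regBimodSum_single _ _ i a b)).trans ?_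
        rw [BalancedTensor.smul_right_tmul, BalancedTensor.smul_left_tmul, OfEnv.smul_of,
          smul_eq_mul, mul_one, hf, one_smul, map_smul, e.apply_symm_apply]
        ext j
        obtain rfl | h := eq_or_ne i j
        · simp
        · rw [Pi.smul_apply, Pi.single_eq_of_ne' h, Pi.single_eq_of_ne' h, smul_zero]
          exact TensorProduct.tmul_zero _ _
      | ha s t hs ht => rw [Pi.single_add, map_add, map_add, hs, ht]
    rw [← Finset.univ_sum_single c, map_sum, map_sum]
    exact Finset.sum_congr rfl fun i _ => key i _
  · induction t using BalancedTensor.induction_on with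
    | h0 => simp
    | ht c x =>
      rw [BalancedTensor.smul_left_tmul]
      induction c using RegBimod.induction_on with
      | h0 => simp [BalancedTensor.zero_tmul]
      | ht a b =>
        rw [OfEnv.smul_of, smul_eq_mul, Env.mk_mul_mk, hf, hf]
        ext i
        rw [Pi.smul_apply, OfEnv.smul_of, smul_eq_mul, Env.mk_mul_mk, mul_one, mul_one]
      | ha s t hs ht => simp only [BalancedTensor.add_tmul, map_add, smul_add, hs, ht]
    | ha s t hs ht => simp only [map_add, smul_add, hs, ht]
  · induction t using BalancedTensor.induction_on with
    | h0 => simp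
    | ht c x =>
      rw [BalancedTensor.smul_right_tmul]
      induction c using RegBimod.induction_on with
      | h0 => simp [BalancedTensor.zero_tmul]
      | ht a b =>
        rw [hf, hf]
        ext i
        rw [Pi.smul_apply, OfEnv.op_smul_of, smul_eq_mul, Env.mk_mul_mk, one_mul, smul_comm,
          map_smul]
        rfl
      | ha s t hs ht => simp only [BalancedTensor.add_tmul, map_add, smul_add, hs, ht]
    | ha s t hs ht => simp only [map_add, smul_add, hs, ht]

/-- The map `a ⊗ b ↦ (xa)_i ⊗ b` for a left linear map `X → R ^ n`. -/
noncomputable def leftCoord {n : ℕ} (e : X →ₗ[R] (Fin n → R)) (x : X) (i : Fin n) :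
    R →ₗ[K] R where
  toFun a := e (op a • x) i
  map_add' b c := by simp [add_smul]
  map_smul' k b := by
    rw [Algebra.smul_def, Algebra.commutes, op_mul, mul_smul, ← IsCentralOver.smul_comm, map_smul]
    exact (Algebra.smul_def _ _).symm

/-- Mirror image of the previous isomorphism: `X ⊗_R (R ⊗_K R) = X ⊗_K R`, unrolled along a left
basis. -/
theorem bimoduleIso_tensor_regBimod {n : ℕ} (e : X ≃ₗ[R] (Fin n → R)) :
    BimoduleIso R (BalancedTensor R X (RegBimod K R)) (Fin n → RegBimod K R) := by
  let φ : X →+ RegBimod K R →+ (Fin n → RegBimod K R) :=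
    AddMonoidHom.flip (AddMonoidHom.mk' (fun c => AddMonoidHom.mk' (fun x i =>
      (LinearMap.rTensor Rᵐᵒᵖ (leftCoord (K := K) e.toLinearMap x i) :
        R ⊗[K] Rᵐᵒᵖ → R ⊗[K] Rᵐᵒᵖ) c)
      fun x y => funext fun i => by
        have : leftCoord (K := K) e.toLinearMap (x + y) i =
          leftCoord e.toLinearMap x i + leftCoord e.toLinearMap y i := by
          ext b
          simp [leftCoord]
        rw [this, LinearMap.rTensor_add]
        rfl) fun c c' => AddMonoidHom.ext fun x => funext fun i => map_add (LinearMap.rTensor Rᵐᵒᵖ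
          (leftCoord (K := K) e.toLinearMap x i)) c c')
  have hφ : ∀ a b x, φ x (OfEnv.of K R (Env.mk K R a b)) =
      fun i => OfEnv.of K R (Env.mk K R (e (op a • x) i) b) := fun a b x => rfl
  let f : BalancedTensor R X (RegBimod K R) →+ (Fin n → RegBimod K R) :=
    BalancedTensor.lift φ (by
      intro s x c
      induction c using RegBimod.induction_on with
      | h0 => simp
      | ht a b =>
        rw [OfEnv.smul_of, smul_eq_mul, Env.mk_mul_mk, mul_one, hφ, hφ, op_mul, mul_smul]
      | ha s t hs ht => simp only [smul_add, map_add, hs, ht])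
  have hf : ∀ a b x, f (BalancedTensor.tmul R x (OfEnv.of K R (Env.mk K R a b))) =
      fun i => OfEnv.of K R (Env.mk K R (e (op a • x) i) b) := hφ
  let g : (Fin n → RegBimod K R) →+ BalancedTensor R X (RegBimod K R) :=
    regBimodSum _ fun i => BalancedTensor.tmul R (e.symm (Pi.single i 1)) (OfEnv.of K R 1)
  refine BimoduleIso.of_inverse f g (fun t => ?_) (fun c => ?_) (fun r t => ?_) (fun r t => ?_)
  · induction t using BalancedTensor.induction_on with
    | h0 => simp
    | ht x c =>
      induction c using RegBimod.induction_on with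
      | h0 => simp [BalancedTensor.tmul_zero]
      | ht a b =>
        rw [hf]
        refine (regBimodSum_apply _ _ _ (fun _ => b)).trans ?_
        have : ∀ i, e (op a • x) i • e.symm (Pi.single i 1) =
            e.symm (Pi.single i (e (op a • x) i)) := fun i => by
          rw [← map_smul, ← Pi.single_smul, smul_eq_mul, mul_one]
        simp_rw [BalancedTensor.smul_right_tmul, BalancedTensor.smul_left_tmul, this,
          ← BalancedTensor.sum_tmul, ← map_sum, Finset.univ_sum_single, e.symm_apply_apply,
          BalancedTensor.smul_tmul]
        rw [OfEnv.op_smul_of, OfEnv.smul_of, smul_smul, Env.mk_mul_mk, mul_one, mul_one,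
          smul_eq_mul, mul_one]
      | ha s t hs ht => simp only [BalancedTensor.tmul_add, map_add, hs, ht]
    | ha s t hs ht => simp only [map_add, hs, ht]
  · have key : ∀ i (c : RegBimod K R), f (g (Pi.single i c)) = Pi.single i c := fun i c => by
      induction c using RegBimod.induction_on with
      | h0 => simp
      | ht a b =>
        refine (congrArg f (regBimodSum_single _ _ i a b)).trans ?_
        rw [BalancedTensor.smul_right_tmul, BalancedTensor.smul_left_tmul, OfEnv.op_smul_of,
          smul_eq_mul, mul_one, hf, op_one, one_smul, map_smul, e.apply_symm_apply]
        ext j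
        obtain rfl | h := eq_or_ne i j
        · simp
        · rw [Pi.smul_apply, Pi.single_eq_of_ne' h, Pi.single_eq_of_ne' h, smul_zero]
          exact TensorProduct.zero_tmul _ _
      | ha s t hs ht => rw [Pi.single_add, map_add, map_add, hs, ht]
    rw [← Finset.univ_sum_single c, map_sum, map_sum]
    exact Finset.sum_congr rfl fun i _ => key i _
  · induction t using BalancedTensor.induction_on with
    | h0 => simp
    | ht x c =>
      rw [BalancedTensor.smul_left_tmul]
      induction c using RegBimod.induction_on with
      | h0 => simp [BalancedTensor.tmul_zero]
      | ht a b =>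
        rw [hf, hf]
        ext i
        rw [Pi.smul_apply, OfEnv.smul_of, smul_eq_mul, Env.mk_mul_mk, mul_one,
          ← smul_comm r (op a) x, map_smul]
        rfl
      | ha s t hs ht => simp only [BalancedTensor.tmul_add, map_add, smul_add, hs, ht]
    | ha s t hs ht => simp only [map_add, smul_add, hs, ht]
  · induction t using BalancedTensor.induction_on with
    | h0 => simp
    | ht x c =>
      rw [BalancedTensor.smul_right_tmul]
      induction c using RegBimod.induction_on with
      | h0 => simp [BalancedTensor.tmul_zero]
      | ht a b =>
        rw [OfEnv.op_smul_of, smul_eq_mul, Env.mk_mul_mk, hf, hf]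
        ext i
        rw [Pi.smul_apply, OfEnv.op_smul_of, smul_eq_mul, Env.mk_mul_mk, one_mul, one_mul]
      | ha s t hs ht => simp only [BalancedTensor.tmul_add, map_add, smul_add, hs, ht]
    | ha s t hs ht => simp only [map_add, smul_add, hs, ht]

end FreeTensor

/-! ### Projective ranks of bimodules and their proportionality. -/

section BimoduleRank

variable {K : Type*} [Field K] {R : Type*} [Ring R] [Algebra K R]

instance [FiniteDimensional K R] : IsArtinianRing (Env K R) :=
  have : Module.Finite K (Env K R) := inferInstanceAs (Module.Finite K (R ⊗[K] Rᵐᵒᵖ))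
  IsArtinianRing.of_finite K (Env K R)

variable (S : Type*) [AddCommGroup S] [Module (Env K R) S]
  (X : Type*) [AddCommGroup X] [Module R X] [Module Rᵐᵒᵖ X] [SMulCommClass R Rᵐᵒᵖ X]
  [IsCentralOver K R X]
  (Y : Type*) [AddCommGroup Y] [Module R Y] [Module Rᵐᵒᵖ Y] [SMulCommClass R Rᵐᵒᵖ Y]
  [IsCentralOver K R Y]
  (T : Type*) [AddCommGroup T] [Module R T] [Module Rᵐᵒᵖ T] [SMulCommClass R Rᵐᵒᵖ T]
  [IsCentralOver K R T]

variable (K R) in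
/-- The projective rank of a bimodule at a simple bimodule `S`. -/
noncomputable def bimodRank : ℕ := projRank (Env K R) S (ToEnv K R X)

variable {X Y T}

theorem bimodRank_congr (h : BimoduleIso R X Y) : bimodRank K R S X = bimodRank K R S Y := by
  obtain ⟨e⟩ := h.toEnv (K := K)
  exact projRank_congr _ _ e

theorem bimodRank_regBimod : bimodRank K R S (RegBimod K R) = projRank (Env K R) S (Env K R) :=
  projRank_congr _ _ (toEnvOfEnv K R (Env K R))

variable [FiniteDimensional K R] [IsSimpleModule (Env K R) S]
variable [Module.Finite R X] [Module.Finite R Y] [Module.Finite R T]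

theorem bimodRank_prod : bimodRank K R S (X × Y) = bimodRank K R S X + bimodRank K R S Y := by
  have := finite_toEnv (K := K) (R := R) (X := X)
  have := finite_toEnv (K := K) (R := R) (X := Y)
  exact (projRank_congr _ _ toEnvProd).trans (projRank_prod _ _)

theorem bimodRank_pi (n : ℕ) : bimodRank K R S (Fin n → X) = n * bimodRank K R S X := by
  have := finite_toEnv (K := K) (R := R) (X := X)
  exact (projRank_congr _ _ (toEnvPi n)).trans (projRank_pi _ _ n)

theorem bimodRank_prod_tensor : bimodRank K R S (BalancedTensor R (X × Y) T) =
    bimodRank K R S (BalancedTensor R X T) + bimodRank K R S (BalancedTensor R Y T) := by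
  have := finite_tensor (R := R) (P := X) (Q := T)
  have := finite_tensor (R := R) (P := Y) (Q := T)
  exact (bimodRank_congr S bimoduleIso_prod_tensor).trans (bimodRank_prod S)

theorem bimodRank_tensor_prod : bimodRank K R S (BalancedTensor R T (X × Y)) =
    bimodRank K R S (BalancedTensor R T X) + bimodRank K R S (BalancedTensor R T Y) := by
  have := finite_tensor (R := R) (P := T) (Q := X)
  have := finite_tensor (R := R) (P := T) (Q := Y)
  exact (bimodRank_congr S bimoduleIso_tensor_prod).trans (bimodRank_prod S)


theorem bimodRank_pi_tensor (n : ℕ) : bimodRank K R S (BalancedTensor R (Fin n → X) T) =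
    n * bimodRank K R S (BalancedTensor R X T) := by
  induction n with
  | zero =>
    have : Subsingleton (ToEnv K R (BalancedTensor R (Fin 0 → X) T)) :=
      BalancedTensor.subsingleton_left
    rw [zero_mul]
    exact projRank_of_subsingleton _ _
  | succ n ih =>
    rw [bimodRank_congr S ((bimoduleIso_cons n).tensor BimoduleIso.refl), bimodRank_prod_tensor,
      ih, add_mul, one_mul, add_comm]

theorem bimodRank_tensor_pi (n : ℕ) : bimodRank K R S (BalancedTensor R T (Fin n → X)) =
    n * bimodRank K R S (BalancedTensor R T X) := by
  induction n with
  | zero =>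
    have : Subsingleton (ToEnv K R (BalancedTensor R T (Fin 0 → X))) :=
      BalancedTensor.subsingleton_right
    rw [zero_mul]
    exact projRank_of_subsingleton _ _
  | succ n ih =>
    rw [bimodRank_congr S (BimoduleIso.refl.tensor (bimoduleIso_cons n)), bimodRank_tensor_prod,
      ih, add_mul, one_mul, add_comm]

/-- Expand the rank of `X ^ n ⊗ X ^ n` along the decomposition. The mixed terms with `Y` are found
by tensoring the decomposition with the regular bimodule on either side, and what is left is the
rank of `Y ⊗ Y`, which is nonnegative. -/
theorem two_mul_le_of_bimoduleIso_prod {d : ℕ} (el : X ≃ₗ[R] (Fin d → R))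
    (er : X ≃ₗ[Rᵐᵒᵖ] (Fin d → R)) (ht : BimoduleIso R (BalancedTensor R X X) (Fin d → X))
    {n s : ℕ} (h : BimoduleIso R (Fin n → X) ((Fin s → RegBimod K R) × Y)) :
    2 * (s * n * d) * bimodRank K R S (RegBimod K R) ≤ n ^ 2 * d * bimodRank K R S X +
      s ^ 2 * Module.finrank K R * bimodRank K R S (RegBimod K R) := by
  obtain ⟨eC⟩ := nonempty_regBimod_equiv (K := K) (R := R)
  set c := bimodRank K R S (RegBimod K R)
  set N := Module.finrank K R
  have hXX : bimodRank K R S (BalancedTensor R X X) = d * bimodRank K R S X :=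
    (bimodRank_congr S ht).trans (bimodRank_pi S d)
  have hCX : bimodRank K R S (BalancedTensor R (RegBimod K R) X) = d * c :=
    (bimodRank_congr S (bimoduleIso_regBimod_tensor er)).trans (bimodRank_pi S d)
  have hXC : bimodRank K R S (BalancedTensor R X (RegBimod K R)) = d * c :=
    (bimodRank_congr S (bimoduleIso_tensor_regBimod el)).trans (bimodRank_pi S d)
  have hCC : bimodRank K R S (BalancedTensor R (RegBimod K R) (RegBimod K R)) = N * c :=
    (bimodRank_congr S (bimoduleIso_tensor_regBimod eC)).trans (bimodRank_pi S N)
  have h1 := bimodRank_congr (K := K) S (h.tensor h)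
  have h2 := bimodRank_congr (K := K) S (h.tensor (BimoduleIso.refl (P := RegBimod K R)))
  have h3 := bimodRank_congr (K := K) S ((BimoduleIso.refl (P := RegBimod K R)).tensor h)
  simp only [bimodRank_prod_tensor, bimodRank_tensor_prod, bimodRank_pi_tensor,
    bimodRank_tensor_pi, hXX, hCX, hXC, hCC] at h1 h2 h3
  nlinarith

end BimoduleRank

section Multiple

variable {K : Type*} [Field K] {R : Type*} [Ring R] [Algebra K R] [FiniteDimensional K R]
  {X : Type*} [AddCommGroup X] [Module R X] [Module Rᵐᵒᵖ X] [SMulCommClass R Rᵐᵒᵖ X]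
  [IsCentralOver K R X] [Module.Finite R X]

theorem exists_bimoduleIso_prod {r : ℕ}
    (h : ∀ I : Submodule (Env K R) (Env K R), IsSimpleModule (Env K R) (Env K R ⧸ I) →
      r * bimodRank K R (Env K R ⧸ I) (RegBimod K R) ≤ bimodRank K R (Env K R ⧸ I) X) :
    ∃ Q : Submodule (Env K R) (ToEnv K R X),
      BimoduleIso R X ((Fin r → RegBimod K R) × OfEnv K R Q) := by
  have := finite_toEnv (K := K) (R := R) (X := X)
  obtain ⟨Q, ⟨e⟩⟩ := exists_equiv_prod_of_projRank_le (E := Env K R) (Y := Fin r → Env K R)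
    (X := ToEnv K R X) fun I hI => by
      rw [projRank_pi, ← bimodRank_regBimod]
      exact h I hI
  let e' : ToEnv K R ((Fin r → RegBimod K R) × OfEnv K R Q) ≃ₗ[Env K R]
      (Fin r → Env K R) × Q :=
    toEnvProd.trans (LinearEquiv.prodCongr ((toEnvPi r).trans
      (LinearEquiv.piCongrRight fun _ => toEnvOfEnv K R (Env K R))) (toEnvOfEnv K R Q))
  exact ⟨Q, bimoduleIso_of_toEnv (e.trans e'.symm)⟩

/-- The rank inequalities make the power of the regular bimodule a summand. By `hd` both sides are
left free of the same rank, so the projection is a surjection between isomorphic noetherian modules,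
hence injective. -/
theorem bimoduleIso_pi_regBimod {d M r : ℕ} (el : X ≃ₗ[R] (Fin d → R))
    (hd : M * d = r * Module.finrank K R)
    (h : ∀ I : Submodule (Env K R) (Env K R), IsSimpleModule (Env K R) (Env K R ⧸ I) →
      r * bimodRank K R (Env K R ⧸ I) (RegBimod K R) ≤ M * bimodRank K R (Env K R ⧸ I) X) :
    BimoduleIso R (Fin M → X) (Fin r → RegBimod K R) := by
  obtain ⟨Q, e, he⟩ := exists_bimoduleIso_prod (X := Fin M → X) fun I hI =>
    (h I hI).trans_eq (bimodRank_pi _ M).symm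
  obtain ⟨eC⟩ := nonempty_regBimod_equiv (K := K) (R := R)
  have σ : Fin M × Fin d ≃ Fin r × Fin (Module.finrank K R) :=
    Fintype.equivOfCardEq (by simpa using hd)
  let eM : (Fin M → X) ≃ₗ[R] (Fin M × Fin d → R) :=
    (LinearEquiv.piCongrRight fun _ => el).trans (LinearEquiv.curry R R (Fin M) (Fin d)).symm
  let er : (Fin r → RegBimod K R) ≃ₗ[R] (Fin r × Fin (Module.finrank K R) → R) :=
    (LinearEquiv.piCongrRight fun _ => eC).trans
      (LinearEquiv.curry R R (Fin r) (Fin (Module.finrank K R))).symm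
  let ε : (Fin r → RegBimod K R) ≃ₗ[R] (Fin M → X) :=
    (er.trans (LinearEquiv.funCongrLeft R R σ)).trans eM.symm
  let f : (Fin M → X) →ₗ[R] (Fin r → RegBimod K R) := LinearMap.fst R _ _ ∘ₗ e.toLinearMap
  have hf : Function.Surjective f := Prod.fst_surjective.comp e.surjective
  have : IsNoetherianRing R := isNoetherian_of_tower K inferInstance
  have hinj : Function.Injective f := by
    have := IsNoetherian.injective_of_surjective_endomorphism (ε.toLinearMap ∘ₗ f)
      (ε.surjective.comp hf)
    exact Function.Injective.of_comp (f := ε) this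
  exact ⟨LinearEquiv.ofBijective f ⟨hinj, hf⟩, fun r x => congrArg Prod.fst (he r x)⟩

/-- The projective ranks of a Galois bimodule that is a generator are proportional to those of the
regular bimodule. -/
theorem finrank_mul_bimodRank {d : ℕ} (el : X ≃ₗ[R] (Fin d → R))
    (er : X ≃ₗ[Rᵐᵒᵖ] (Fin d → R)) (ht : BimoduleIso R (BalancedTensor R X X) (Fin d → X))
    (hpos : ∀ I : Submodule (Env K R) (Env K R), IsSimpleModule (Env K R) (Env K R ⧸ I) →
      0 < bimodRank K R (Env K R ⧸ I) X)
    (I : Submodule (Env K R) (Env K R)) (hI : IsSimpleModule (Env K R) (Env K R ⧸ I)) :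
    Module.finrank K R * bimodRank K R (Env K R ⧸ I) X =
      d * bimodRank K R (Env K R ⧸ I) (RegBimod K R) := by
  let E := Env K R
  let a : Submodule E E → ℕ := fun I => bimodRank K R (E ⧸ I) X
  let c : Submodule E E → ℕ := fun I => bimodRank K R (E ⧸ I) (RegBimod K R)
  -- Every `c I` is at most the length of `E`, hence divides `F`. Thus `a I * (F / c I)` is the
  -- ratio `a I / c I` scaled to a natural number, and a minimum exists without counting simple
  -- modules.
  let F := (Module.length E E).toNat.factorial
  have hF : 0 < F := Nat.factorial_pos _
  have hc : ∀ I, IsSimpleModule E (E ⧸ I) → 0 < c I ∧ c I ∣ F := fun I hI => by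
    have h0 : 0 < c I := by
      simp only [c, bimodRank_regBimod]
      exact projRank_self_pos _ _
    refine ⟨h0, Nat.dvd_factorial h0 ?_⟩
    simp only [c, bimodRank_regBimod]
    exact projRank_self_le _ _
  obtain ⟨J, hJ, hmin⟩ := exists_minimalFor_of_wellFoundedLT
    (fun I : Submodule E E => IsSimpleModule E (E ⧸ I)) (fun I => a I * (F / c I)) ⟨I, hI⟩
  have hcross : ∀ I, IsSimpleModule E (E ⧸ I) → a J * c I ≤ c J * a I := fun I hI => by
    have h1 : a J * (F / c J) ≤ a I * (F / c I) := by
      obtain h | h := le_total (a J * (F / c J)) (a I * (F / c I))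
      · exact h
      · exact hmin hI h
    obtain ⟨hJ0, hJ1⟩ := hc J hJ
    obtain ⟨hI0, hI1⟩ := hc I hI
    refine Nat.le_of_mul_le_mul_left (?_ : F * (a J * c I) ≤ F * (c J * a I)) hF
    calc F * (a J * c I) = a J * (F / c J) * (c I * c J) := by
          nth_rewrite 1 [← Nat.div_mul_cancel hJ1]; ring
      _ ≤ a I * (F / c I) * (c I * c J) := Nat.mul_le_mul_right _ h1
      _ = F * (c J * a I) := by
          nth_rewrite 2 [← Nat.div_mul_cancel hI1]; ring
  -- Minimality of the ratio at `J` makes `a J` copies of the regular bimodule a summand of `c J`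
  -- copies of `X`.
  obtain ⟨Q, hQ⟩ := exists_bimoduleIso_prod (K := K) (X := Fin (c J) → X) (r := a J)
    fun I hI => (hcross I hI).trans_eq (bimodRank_pi _ _).symm
  have : Module.Finite R (OfEnv K R Q) := by
    obtain ⟨e, -⟩ := hQ
    exact Module.Finite.of_surjective (LinearMap.snd R _ _ ∘ₗ e.toLinearMap)
      (Prod.snd_surjective.comp e.surjective)
  have h2 : 2 * (a J * c J * d) * c J ≤ c J ^ 2 * d * a J + a J ^ 2 * Module.finrank K R * c J :=
    two_mul_le_of_bimoduleIso_prod (E ⧸ J) el er ht hQ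
  -- Cancelling `a J * c J`, positive since `X` is a generator, bounds the minimal ratio below by d
  -- / [R : K].
  have h3 : d * c J ≤ Module.finrank K R * a J := by
    refine Nat.le_of_mul_le_mul_left (?_ : (a J * c J) * _ ≤ (a J * c J) * _)
      (Nat.mul_pos (hpos J hJ) (hc J hJ).1)
    nlinarith
  -- Minimality carries the bound to every simple module, so `bimoduleIso_pi_regBimod` applies with
  -- both left ranks equal to d [R : K].
  have h4 : ∀ I, IsSimpleModule E (E ⧸ I) → d * c I ≤ Module.finrank K R * a I := fun I hI => by
    refine Nat.le_of_mul_le_mul_left (?_ : c J * _ ≤ c J * _) (hc J hJ).1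
    calc c J * (d * c I) = (d * c J) * c I := by ring
      _ ≤ (Module.finrank K R * a J) * c I := Nat.mul_le_mul_right _ h3
      _ = Module.finrank K R * (a J * c I) := by ring
      _ ≤ Module.finrank K R * (c J * a I) := Nat.mul_le_mul_left _ (hcross I hI)
      _ = _ := by ring
  have h5 := bimodRank_congr (K := K) (E ⧸ I)
    (bimoduleIso_pi_regBimod (M := Module.finrank K R) (r := d) el (mul_comm _ _) h4)
  rwa [bimodRank_pi, bimodRank_pi] at h5

end Multiple

/-! ### Coefficients and the generator property. -/

section Coefficient

variable {R : Type*} [Ring R] {X : Type*} [AddCommGroup X] [Module R X] [Module Rᵐᵒᵖ X]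

/-- The endomorphism `b ↦ φ(pb)` attached to a left linear functional `φ` and a vector `p`. -/
def coeff (φ : X →ₗ[R] R) (p : X) : R →+ R where
  toFun b := φ (op b • p)
  map_zero' := by simp
  map_add' b c := by simp [add_smul]

@[simp]
theorem coeff_apply (φ : X →ₗ[R] R) (p : X) (b : R) : coeff φ p b = φ (op b • p) := rfl

variable (R X) in
/-- The additive span of the endomorphisms `b ↦ φ(pb)`. -/
def coeffSpan : AddSubgroup (R →+ R) :=
  AddSubgroup.closure {t | ∃ (φ : X →ₗ[R] R) (p : X), t = coeff φ p}

end Coefficient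

section Generator

variable (K : Type*) [Field K] (R : Type*) [Ring R] [Algebra K R]

/-- The right `R`-module structure on the dual of `R`. -/
abbrev rightDualModule : Module Rᵐᵒᵖ (R →ₗ[K] K) where
  smul c f := f ∘ₗ LinearMap.mulLeft K (unop c)
  one_smul f := LinearMap.ext fun b => congrArg f (one_mul b)
  mul_smul _ _ f := LinearMap.ext fun _ => congrArg f (mul_assoc _ _ _)
  smul_zero _ := rfl
  smul_add _ _ _ := rfl
  add_smul _ _ f := LinearMap.ext fun _ =>
    (congrArg f (add_mul _ _ _)).trans (map_add f _ _)
  zero_smul f := LinearMap.ext fun _ => (congrArg f (zero_mul _)).trans (map_zero f)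

/-- A right linear map from the dual of `R` to `R`. -/
structure RightDualHom where
  /-- The underlying map. -/
  toFun : (R →ₗ[K] K) →+ R
  map_comp_mulLeft : ∀ (f : R →ₗ[K] K) (c : R), toFun (f ∘ₗ LinearMap.mulLeft K c) = toFun f * c

variable {K R}

/-- A right linear map from the dual, as a linear map over `K`. -/
def RightDualHom.toLinear (γ : RightDualHom K R) : (R →ₗ[K] K) →ₗ[K] Rᵐᵒᵖ where
  toFun f := op (γ.toFun f)
  map_add' f g := by rw [← op_add, ← map_add]
  map_smul' k f := by
    have h : k • f = f ∘ₗ LinearMap.mulLeft K (algebraMap K R k) := by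
      ext b
      simp [← Algebra.smul_def]
    rw [RingHom.id_apply, h, γ.map_comp_mulLeft, ← Algebra.commutes, ← Algebra.smul_def, op_smul]

variable [FiniteDimensional K R]

/-- The bimodule map `End_K(R) → R ⊗ R` induced by a right linear map `R^* → R`. -/
noncomputable def endToEnv (γ : RightDualHom K R) : (R →ₗ[K] R) →ₗ[K] Env K R :=
  (TensorProduct.map LinearMap.id (γ.toLinear) : R ⊗[K] Module.Dual K R →ₗ[K]
    R ⊗[K] Rᵐᵒᵖ) ∘ₗ (TensorProduct.comm K (Module.Dual K R) R).toLinearMap ∘ₗ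
    (dualTensorHomEquiv K R R).symm.toLinearMap

theorem endToEnv_dualTensorHom (γ : RightDualHom K R) (f : R →ₗ[K] K) (a : R) :
    endToEnv γ (dualTensorHom K R R (f ⊗ₜ a)) = Env.mk K R a (γ.toFun f) := by
  have : (dualTensorHomEquiv K R R).symm (dualTensorHom K R R (f ⊗ₜ a)) = f ⊗ₜ a := by
    rw [LinearEquiv.symm_apply_eq]; rfl
  refine (congrArg (fun t => (TensorProduct.map LinearMap.id γ.toLinear :
    R ⊗[K] Module.Dual K R →ₗ[K] R ⊗[K] Rᵐᵒᵖ) (TensorProduct.comm K (Module.Dual K R) R t))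
    this).trans rfl

theorem endo_induction {p : (R →ₗ[K] R) → Prop} (T : R →ₗ[K] R)
    (h : ∀ f a, p (dualTensorHom K R R (f ⊗ₜ a))) (h0 : p 0)
    (ha : ∀ S T, p S → p T → p (S + T)) : p T := by
  obtain ⟨t, rfl⟩ := (dualTensorHomEquiv K R R).surjective T
  induction t with
  | zero => rwa [map_zero]
  | tmul f a => exact h f a
  | add s t hs ht => rw [map_add]; exact ha _ _ hs ht

theorem endToEnv_mulLeft_comp (γ : RightDualHom K R) (r : R) (T : R →ₗ[K] R) :
    endToEnv γ (LinearMap.mulLeft K r ∘ₗ T) = Env.mk K R r 1 * endToEnv γ T := by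
  induction T using endo_induction with
  | h f a =>
    have : LinearMap.mulLeft K r ∘ₗ dualTensorHom K R R (f ⊗ₜ a) =
        dualTensorHom K R R (f ⊗ₜ (r * a)) := by
      ext b
      simp
    rw [this, endToEnv_dualTensorHom, endToEnv_dualTensorHom, Env.mk_mul_mk, mul_one]
  | h0 => simp
  | ha S T hS hT => rw [LinearMap.comp_add, map_add, map_add, hS, hT, mul_add]

theorem endToEnv_comp_mulLeft (γ : RightDualHom K R) (c : R) (T : R →ₗ[K] R) :
    endToEnv γ (T ∘ₗ LinearMap.mulLeft K c) = Env.mk K R 1 c * endToEnv γ T := by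
  induction T using endo_induction with
  | h f a =>
    have : dualTensorHom K R R (f ⊗ₜ a) ∘ₗ LinearMap.mulLeft K c =
        dualTensorHom K R R ((f ∘ₗ LinearMap.mulLeft K c) ⊗ₜ a) := by
      ext b
      simp
    rw [this, endToEnv_dualTensorHom, endToEnv_dualTensorHom, Env.mk_mul_mk, one_mul]
    exact congrArg (Env.mk K R a) (γ.map_comp_mulLeft f c)
  | h0 => simp
  | ha S T hS hT => rw [LinearMap.add_comp, map_add, map_add, hS, hT, mul_add]

/-- The dual of a semisimple algebra is a generator. -/
theorem exists_sum_rightDual [IsSemisimpleRing R] :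
    ∃ (n : ℕ) (f : Fin n → (R →ₗ[K] K)) (b : Fin n → R)
      (γ : Fin n → RightDualHom K R), (∀ i, f i (b i) = 1) ∧ ∑ i, (γ i).toFun (f i) = 1 := by
  let _ := rightDualModule K R
  let b := Module.finBasis K R
  -- Coordinates of left multiplications embed `R` in a power of its dual as a right module.
  -- Semisimplicity yields a retraction, whose components are the `γ i`; since `j 1` is the dual
  -- basis, retracting it gives the sum equal to 1.
  let j : R →ₗ[Rᵐᵒᵖ] (Fin (Module.finrank K R) → (R →ₗ[K] K)) :=
    { toFun := fun a i => b.coord i ∘ₗ LinearMap.mulLeft K a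
      map_add' := fun a a' => funext fun i => LinearMap.ext fun c => by
        simp only [LinearMap.comp_apply, LinearMap.mulLeft_apply, add_mul, map_add]
        rfl
      map_smul' := fun c a => funext fun i => LinearMap.ext fun x =>
        congrArg (b.coord i) (mul_assoc a (unop c) x) }
  have hj : Function.Injective j := fun a a' h => by
    refine b.ext_elem fun i => ?_
    have : b.coord i (a * 1) = b.coord i (a' * 1) := LinearMap.congr_fun (congrFun h i) 1
    simpa using this
  obtain ⟨ρ, hρ⟩ := IsSemisimpleModule.extension_property j hj LinearMap.id
  refine ⟨_, fun i => b.coord i, b, fun i =>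
    ⟨(ρ ∘ₗ LinearMap.single Rᵐᵒᵖ (fun _ => R →ₗ[K] K) i).toAddMonoidHom, fun f c =>
      (ρ ∘ₗ LinearMap.single Rᵐᵒᵖ (fun _ => R →ₗ[K] K) i).map_smul (op c) f⟩,
    fun i => by simp, ?_⟩
  have h1 := LinearMap.congr_fun hρ 1
  rw [LinearMap.comp_apply, LinearMap.id_apply, ← Finset.univ_sum_single (j 1), map_sum] at h1
  refine Eq.trans (Finset.sum_congr rfl fun i _ => ?_) h1
  refine congrArg (fun t => ρ (Pi.single i t)) (LinearMap.ext fun c => ?_)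
  exact congrArg (b.coord i) (one_mul c).symm

variable {X : Type*} [AddCommGroup X] [Module R X] [Module Rᵐᵒᵖ X] [SMulCommClass R Rᵐᵒᵖ X]
  [IsCentralOver K R X]

variable (K) in
/-- The endomorphism `b ↦ φ(pb)` as a linear map over `K`. -/
def coeffLin (φ : X →ₗ[R] R) (p : X) : R →ₗ[K] R :=
  { coeff φ p with
    map_smul' := fun k b => by
      change φ (op (k • b) • p) = k • φ (op b • p)
      rw [Algebra.smul_def, Algebra.commutes, op_mul, mul_smul, ← IsCentralOver.smul_comm, map_smul,
        smul_eq_mul, Algebra.smul_def] }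

/-- A bimodule over a semisimple algebra all of whose linear endomorphisms are sums of coefficients
of the bimodule is a generator. -/
theorem bimodRank_pos [IsSemisimpleRing R] [Module.Finite R X]
    (hX : ∀ T : R →ₗ[K] R, T.toAddMonoidHom ∈ coeffSpan R X)
    (I : Submodule (Env K R) (Env K R)) (hI : IsSimpleModule (Env K R) (Env K R ⧸ I)) :
    0 < bimodRank K R (Env K R ⧸ I) X := by
  have := finite_toEnv (K := K) (R := R) (X := X)
  by_contra hneg
  -- If the rank vanished, every bimodule map from `X` to the enveloping algebra would land in the
  -- proper left ideal `I`; the rest produces 1 in `I`.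
  have key : ∀ f : ToEnv K R X →ₗ[Env K R] Env K R, ∀ x, f x ∈ I := fun f x => by
    by_contra hx
    refine hneg (projRank_pos _ _ f I.mkQ fun h0 => hx ?_)
    simpa using LinearMap.congr_fun h0 x
  have h1 : ∀ (γ : RightDualHom K R) (T : R →ₗ[K] R), endToEnv γ T ∈ I := fun γ T => by
    let J : AddSubgroup (R →+ R) :=
      (I.toAddSubgroup.comap (endToEnv γ).toAddMonoidHom).map
        (LinearMap.toAddMonoidHom' : (R →ₗ[K] R) →+ (R →+ R))
    have hJ : coeffSpan R X ≤ J := (AddSubgroup.closure_le _).2 (by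
      rintro _ ⟨φ, p, rfl⟩
      refine ⟨coeffLin K φ p, ?_, rfl⟩
      -- For fixed `φ`, sending `p` to its coefficient is a bimodule map into End_K(R), with `R`
      -- acting through left multiplications by post- and precomposition.
      let G : ToEnv K R X →ₗ[Env K R] Env K R := envHom
        (AddMonoidHom.mk' (fun p => endToEnv γ (coeffLin K φ p)) fun p q => by
          rw [← map_add]
          congr 1
          ext b
          simp [coeffLin])
        (fun r p => by
          change endToEnv γ _ = _ * endToEnv γ _
          rw [← endToEnv_mulLeft_comp]
          congr 1
          ext b
          simp [coeffLin, ← smul_comm r (op b) p])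
        (fun r p => by
          change endToEnv γ _ = _ * endToEnv γ _
          rw [← endToEnv_comp_mulLeft]
          congr 1
          ext b
          simp [coeffLin, smul_smul])
      exact key G (ToEnv.of K R p))
    obtain ⟨T', hT', h⟩ := hJ (hX T)
    have : T' = T := LinearMap.ext fun b => DFunLike.congr_fun h b
    rwa [← this]
  obtain ⟨n, f, b, γ, -, h⟩ := exists_sum_rightDual (K := K) (R := R)
  -- The rank-one operators `f i ⊗ 1` go to `1 ⊗ γ i (f i)`, whose sum is 1.
  have h2 : (1 : Env K R) ∈ I := by
    have : ∑ i, endToEnv (γ i) (dualTensorHom K R R (f i ⊗ₜ 1)) ∈ I :=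
      Submodule.sum_mem _ fun i _ => h1 _ _
    simp only [endToEnv_dualTensorHom] at this
    have h3 : ∑ i, Env.mk K R 1 ((γ i).toFun (f i)) = Env.mk K R 1 (∑ i, (γ i).toFun (f i)) := by
      exact (map_sum (((TensorProduct.mk K R Rᵐᵒᵖ 1).toAddMonoidHom.comp
        (opAddEquiv (α := R)).toAddMonoidHom : R →+ R ⊗[K] Rᵐᵒᵖ)) _ _).symm
    rwa [h3, h, Env.mk_one] at this
  have : I = ⊤ := (Ideal.eq_top_iff_one I).2 h2
  exact (isSimpleModule_iff_isCoatom.1 hI).1 this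

end Generator

/-! ### Reversing a vanishing condition for central idempotents. -/

section Idempotent

variable {R : Type*} [Ring R] {P : Type*} [AddCommGroup P] [Module R P] [Module Rᵐᵒᵖ P]
  [SMulCommClass R Rᵐᵒᵖ P] {Q : Type*} [AddCommGroup Q] [Module R Q]

/-- `P ⊗_R Q ≅ P ^ d` as left modules when `Q` is left free of rank `d`. -/
theorem exists_tensor_equiv_of_free {d : ℕ} (e : Q ≃ₗ[R] (Fin d → R)) :
    ∃ f : BalancedTensor R P Q ≃ₗ[R] (Fin d → P),
      ∀ x y, f (BalancedTensor.tmul R x y) = fun i => op (e y i) • x := by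
  let φ : P →+ Q →+ (Fin d → P) := AddMonoidHom.mk' (fun x => AddMonoidHom.mk'
    (fun y i => op (e y i) • x) fun y y' => funext fun i => by simp [add_smul])
    fun x x' => AddMonoidHom.ext fun y => funext fun i => smul_add _ _ _
  let f : BalancedTensor R P Q →+ (Fin d → P) := BalancedTensor.lift φ fun s x y =>
    funext fun i => by simp [φ, smul_smul]
  let g : (Fin d → P) →+ BalancedTensor R P Q := AddMonoidHom.mk'
    (fun x => ∑ i, BalancedTensor.tmul R (x i) (e.symm (Pi.single i 1))) fun x y => by
      simp only [Pi.add_apply, BalancedTensor.add_tmul, Finset.sum_add_distrib]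
  refine ⟨{ f with
    map_smul' := fun r t => ?_
    invFun := g
    left_inv := fun t => ?_
    right_inv := fun x => ?_ }, fun x y => rfl⟩
  · change f (r • t) = r • f t
    induction t using BalancedTensor.induction_on with
    | h0 => simp
    | ht x y => exact funext fun i => (smul_comm r (op (e y i)) x).symm
    | ha s t hs ht => simp only [smul_add, map_add, hs, ht]
  · change g (f t) = t
    induction t using BalancedTensor.induction_on with
    | h0 => simp
    | ht x y =>
      change ∑ i, BalancedTensor.tmul R (op (e y i) • x) (e.symm (Pi.single i 1)) = _
      simp_rw [BalancedTensor.smul_tmul, ← BalancedTensor.tmul_sum, ← map_smul, ← Pi.single_smul,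
        smul_eq_mul, mul_one, ← map_sum, Finset.univ_sum_single, e.symm_apply_apply]
    | ha s t hs ht => simp only [map_add, hs, ht]
  · change f (∑ i, BalancedTensor.tmul R (x i) (e.symm (Pi.single i 1))) = x
    rw [map_sum]
    ext j
    rw [Finset.sum_apply, Finset.sum_eq_single j]
    · simp [f, φ]
    · intro i _ h
      simp [f, φ, Pi.single_eq_of_ne' h]
    · simp

/-- A right coordinate P → R induces P ⊗ Q → Q, which recovers `w` from `x ⊗ w` for a suitable basis
vector `x`. -/
theorem eq_zero_of_forall_tmul_eq_zero {d : ℕ} (hd : 1 ≤ d) (er : P ≃ₗ[Rᵐᵒᵖ] (Fin d → R)) {w : Q}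
    (h : ∀ x : P, BalancedTensor.tmul R x w = 0) : w = 0 := by
  let φ : P →+ Q →+ Q := AddMonoidHom.mk' (fun x => AddMonoidHom.mk'
    (fun y => er x ⟨0, hd⟩ • y) fun y y' => smul_add _ _ _)
    fun x x' => AddMonoidHom.ext fun y => by simp [add_smul]
  let f : BalancedTensor R P Q →+ Q := BalancedTensor.lift φ fun s x y => by
    simp [φ, smul_smul]
  have := congrArg f (h (er.symm (Pi.single ⟨0, hd⟩ 1)))
  simpa [f, φ] using this

/-- From gP(1 - g) = 0 one deduces (1 - g)Pg = 0. Since gP = gPg, the submodule Pg ⊗ P = P ⊗ gP lies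
in (P ⊗ P)g. As left modules both are (Pg)^d, one by left freeness of the second factor and the
other by P ⊗ P ≅ P^d, so finite length makes them equal. Hence x ⊗ pg = xg ⊗ pg = x ⊗ gpg for all x,
and x can be cancelled. -/
theorem IsGalois.op_smul_eq_of_smul_eq [IsArtinianRing R] {d : ℕ} (hP : IsGalois R P d) {g : R}
    (hg : g * g = g) (hc : ∀ r, g * r = r * g) (h : ∀ p : P, g • p = g • op g • p) (p : P) :
    op g • p = g • op g • p := by
  obtain ⟨hd, ⟨el⟩, ⟨er⟩, Θ, hΘ⟩ := hP
  obtain ⟨Λ, hΛ⟩ := exists_tensor_equiv_of_free (P := P) el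
  have : Module.Finite R P := Module.Finite.equiv el.symm
  let T := BalancedTensor R P P
  have hT : Module.Finite R T := Module.Finite.equiv Λ.symm
  have hTa : IsArtinian R T := inferInstance
  let ρ : (Fin d → P) →ₗ[R] (Fin d → P) := 
    { toFun := fun x => op g • x
      map_add' := smul_add _
      map_smul' := fun r x => (smul_comm r (op g) x).symm }
  -- `A` multiplies by `g` on the outer right and `B` in the middle; both are conjugate to right
  -- multiplication by `g` on `P ^ d`.
  let A : T →ₗ[R] T := Θ.symm.toLinearMap ∘ₗ ρ ∘ₗ Θ.toLinearMap
  let B : T →ₗ[R] T := Λ.symm.toLinearMap ∘ₗ ρ ∘ₗ Λ.toLinearMap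
  have hA : ∀ t, A t = op g • t := fun t => by
    change Θ.symm (op g • Θ t) = _
    rw [LinearEquiv.symm_apply_eq, hΘ]
  have hB : ∀ x y, B (BalancedTensor.tmul R x y) = BalancedTensor.tmul R (op g • x) y :=
    fun x y => by
      change Λ.symm (op g • Λ _) = _
      rw [LinearEquiv.symm_apply_eq, hΛ, hΛ]
      ext i
      simp [smul_smul, ← op_mul, hc]
  have hAB : ∀ t, A (B t) = B t := fun t => by
    induction t using BalancedTensor.induction_on with
    | h0 => simp
    | ht x y =>
      rw [hB, hA, BalancedTensor.smul_right_tmul, BalancedTensor.smul_tmul,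
        BalancedTensor.smul_tmul, ← h]
    | ha s t hs ht => simp only [map_add, hs, ht]
  have hBB : ∀ t, B (B t) = B t := fun t => by
    induction t using BalancedTensor.induction_on with
    | h0 => simp
    | ht x y => rw [hB, hB, smul_smul, ← op_mul, hg]
    | ha s t hs ht => simp only [map_add, hs, ht]
  have hle : LinearMap.range B ≤ LinearMap.range A := by
    rintro _ ⟨t, rfl⟩
    exact ⟨B t, hAB t⟩
  have hrA : LinearMap.range A = (LinearMap.range ρ).map Θ.symm.toLinearMap := by
    rw [LinearMap.range_comp, LinearMap.range_comp_of_range_eq_top _ Θ.range]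
  have hrB : LinearMap.range B = (LinearMap.range ρ).map Λ.symm.toLinearMap := by
    rw [LinearMap.range_comp, LinearMap.range_comp_of_range_eq_top _ Λ.range]
  let ε : LinearMap.range A ≃ₗ[R] LinearMap.range B :=
    (LinearEquiv.ofEq _ _ hrA).trans ((Θ.symm.submoduleMap _).symm.trans
      ((Λ.symm.submoduleMap _).trans (LinearEquiv.ofEq _ _ hrB.symm)))
  have hsurj := (IsArtinian.bijective_of_injective_endomorphism
    (Submodule.inclusion hle ∘ₗ ε.toLinearMap)
    ((Submodule.inclusion_injective hle).comp ε.injective)).2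
  have hBA : ∀ t, B (A t) = A t := fun t => by
    obtain ⟨y, hy⟩ := hsurj ⟨A t, t, rfl⟩
    obtain ⟨z, hz⟩ := (ε y).2
    have : B z = A t := hz.trans (congrArg Subtype.val hy)
    rw [← this, hBB]
  rw [eq_comm, ← sub_eq_zero]
  refine eq_zero_of_forall_tmul_eq_zero hd er fun x => ?_
  have h1 := hBA (BalancedTensor.tmul R x p)
  rw [hA, BalancedTensor.smul_right_tmul, hB, BalancedTensor.smul_tmul] at h1
  rw [← BalancedTensor.tmulHom_apply, map_sub, BalancedTensor.tmulHom_apply,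
    BalancedTensor.tmulHom_apply, h1, sub_self]

end Idempotent

/-! ### The ring generated by coefficients and multiplications. -/

section CoeffRing

variable {R : Type*} [Ring R] {P : Type*} [AddCommGroup P] [Module R P] [Module Rᵐᵒᵖ P]
  [SMulCommClass R Rᵐᵒᵖ P]

/-- The endomorphism `b ↦ abc` of the additive group of a ring. -/
def mulBoth (a c : R) : AddMonoid.End R := (AddMonoidHom.mulRight c).comp (AddMonoidHom.mulLeft a)

@[simp]
theorem mulBoth_apply (a b c : R) : mulBoth a c b = a * b * c := rfl

variable (R P) in
/-- Coefficients and multiplications. -/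
def coeffGen : Set (AddMonoid.End R) :=
  {t | ∃ (φ : P →ₗ[R] R) (p : P), t = coeff φ p} ∪ {t | ∃ a c, t = mulBoth a c}

theorem mulBoth_comp_coeff (a c : R) (φ : P →ₗ[R] R) (p : P) :
    (mulBoth a c).comp (coeff φ p) = coeff (LinearMap.toSpanSingleton R R c ∘ₗ φ) (a • p) := by
  ext b
  change a * φ (op b • p) * c = φ (op b • a • p) * c
  rw [← smul_comm a (op b) p, φ.map_smul a, smul_eq_mul]

/-- Right multiplication by an element of `R`, as a left linear map. -/
def rightMulLin (P : Type*) [AddCommGroup P] [Module R P] [Module Rᵐᵒᵖ P]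
    [SMulCommClass R Rᵐᵒᵖ P] (c : R) : P →ₗ[R] P where
  toFun x := op c • x
  map_add' := smul_add _
  map_smul' r x := (smul_comm r (op c) x).symm

theorem coeff_comp_mulBoth (a c : R) (φ : P →ₗ[R] R) (p : P) :
    (coeff φ p).comp (mulBoth a c) = coeff (φ ∘ₗ rightMulLin P c) (op a • p) := by
  ext b
  change φ (op (a * b * c) • p) = φ (op c • op b • op a • p)
  simp [mul_smul]

/-- The composite at b is the functional x ⊗ y ↦ φ(xψ(y)) evaluated at (p ⊗ q)b. Transported along P
⊗ P ≅ P^d, this is a sum of d coefficients. -/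
theorem coeff_comp_coeff_mem {d : ℕ} (ht : BimoduleIso R (BalancedTensor R P P) (Fin d → P))
    (φ ψ : P →ₗ[R] R) (p q : P) : (coeff φ p).comp (coeff ψ q) ∈ coeffSpan R P := by
  obtain ⟨Θ, hΘ⟩ := ht
  let Φ' : BalancedTensor R P P →+ R := BalancedTensor.lift
    (AddMonoidHom.mk' (fun x => AddMonoidHom.mk' (fun y => φ (op (ψ y) • x))
      fun y y' => by simp [add_smul]) fun x x' => AddMonoidHom.ext fun y => by simp)
    fun s x y => by simp [smul_smul]
  let Φ : BalancedTensor R P P →ₗ[R] R :=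
    { Φ' with
      map_smul' := fun r t => by
        change Φ' (r • t) = r • Φ' t
        induction t using BalancedTensor.induction_on with
        | h0 => simp
        | ht x y =>
          change φ (op (ψ y) • r • x) = r • φ (op (ψ y) • x)
          rw [← map_smul, ← smul_comm r (op (ψ y)) x]
        | ha s t hs ht => simp only [smul_add, map_add, hs, ht] }
  have : (coeff φ p).comp (coeff ψ q) = ∑ i : Fin d,
      coeff (Φ ∘ₗ Θ.symm.toLinearMap ∘ₗ LinearMap.single R (fun _ : Fin d => P) i)
        (Θ (BalancedTensor.tmul R p q) i) := by
    ext b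
    have h1 : (coeff φ p).comp (coeff ψ q) b =
        Φ (Θ.symm (op b • Θ (BalancedTensor.tmul R p q))) := by
      rw [← hΘ, Θ.symm_apply_apply]
      rfl
    rw [h1, ← Finset.univ_sum_single (op b • Θ (BalancedTensor.tmul R p q)), map_sum, map_sum,
      AddMonoidHom.finsetSum_apply]
    rfl
  rw [this]
  exact AddSubgroup.sum_mem _ fun i _ => AddSubgroup.subset_closure ⟨_, _, rfl⟩

theorem mul_mem_closure_of_forall {E : Type*} [Ring E] {s t : Set E} {U : AddSubgroup E}
    (h : ∀ a ∈ s, ∀ b ∈ t, a * b ∈ U) {x y : E} (hx : x ∈ AddSubgroup.closure s)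
    (hy : y ∈ AddSubgroup.closure t) : x * y ∈ U := by
  have h1 : ∀ a ∈ s, AddSubgroup.closure t ≤ U.comap (AddMonoidHom.mulLeft a) := fun a ha =>
    (AddSubgroup.closure_le _).2 fun b hb => h a ha b hb
  have h2 : AddSubgroup.closure s ≤ U.comap (AddMonoidHom.mulRight y) :=
    (AddSubgroup.closure_le _).2 fun a ha => h1 a ha hy
  exact h2 hx

/-- The coefficients span a two-sided ideal in the ring they generate with the multiplications. This
is what later upgrades density of the ring to density of the span. -/
theorem mul_mem_coeffSpan {t u v : AddMonoid.End R} (ht : t ∈ AddSubgroup.closure (coeffGen R P))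
    (hu : u ∈ coeffSpan R P) (hv : v ∈ AddSubgroup.closure (coeffGen R P))
    {d : ℕ} (hP : BimoduleIso R (BalancedTensor R P P) (Fin d → P)) :
    t * u * v ∈ coeffSpan R P := by
  refine mul_mem_closure_of_forall (U := coeffSpan R P) ?_
    (mul_mem_closure_of_forall (U := coeffSpan R P) ?_ ht hu) hv
  · rintro _ ⟨φ, p, rfl⟩ _ (⟨ψ, q, rfl⟩ | ⟨a, c, rfl⟩)
    · exact coeff_comp_coeff_mem hP _ _ _ _
    · exact AddSubgroup.subset_closure ⟨_, _, coeff_comp_mulBoth a c φ p⟩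
  · rintro _ (⟨ψ, q, rfl⟩ | ⟨a, c, rfl⟩) _ ⟨φ, p, rfl⟩
    · exact coeff_comp_coeff_mem hP _ _ _ _
    · exact AddSubgroup.subset_closure ⟨_, _, mulBoth_comp_coeff a c φ p⟩

theorem coeffSpan_le : coeffSpan R P ≤ AddSubgroup.closure (coeffGen R P) :=
  AddSubgroup.closure_mono Set.subset_union_left

variable (P) in
theorem mulBoth_mem (a c : R) : mulBoth a c ∈ AddSubgroup.closure (coeffGen R P) :=
  AddSubgroup.subset_closure (Or.inr ⟨a, c, rfl⟩)

theorem mulBoth_one : mulBoth (1 : R) 1 = 1 := by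
  ext b
  simp

/-- The ring of endomorphisms generated by the coefficients and the multiplications. -/
def coeffRing {d : ℕ} (hP : BimoduleIso R (BalancedTensor R P P) (Fin d → P)) :
    Subring (AddMonoid.End R) where
  __ := AddSubgroup.closure (coeffGen R P)
  one_mem' := mulBoth_one (R := R) ▸ mulBoth_mem P 1 1
  mul_mem' {x y} hx hy := by
    have h1 : (1 : AddMonoid.End R) ∈ AddSubgroup.closure (coeffGen R P) :=
      mulBoth_one (R := R) ▸ mulBoth_mem P 1 1
    refine mul_mem_closure_of_forall (U := AddSubgroup.closure (coeffGen R P)) ?_ hx hy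
    rintro u (⟨ψ, q, rfl⟩ | ⟨a, c, rfl⟩) v hv
    · have := mul_mem_coeffSpan h1 (AddSubgroup.subset_closure ⟨ψ, q, rfl⟩)
        (AddSubgroup.subset_closure hv) hP
      exact coeffSpan_le ((one_mul (M := AddMonoid.End R) (coeff ψ q)) ▸ this)
    · obtain ⟨φ, p, rfl⟩ | ⟨a', c', rfl⟩ := hv
      · exact coeffSpan_le (AddSubgroup.subset_closure ⟨_, _, mulBoth_comp_coeff a c φ p⟩)
      · refine AddSubgroup.subset_closure (Or.inr ⟨a * a', c' * c, ?_⟩)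
        ext b
        change a * (a' * b * c') * c = _
        simp [mul_assoc]

section Artinian

variable (A : Type*) [CommRing A] [IsArtinianRing A] [Algebra A R] [Module.Finite A R]

/-- The coefficient map as a bilinear map. -/
def coeffBilin [Module A P] [IsScalarTower A R P] :
    (P →ₗ[R] R) →ₗ[A] P →ₗ[A] (R →+ R) where
  toFun φ :=
    { toFun := coeff φ
      map_add' := fun p q => by ext b; simp
      map_smul' := fun a p => by
        ext b
        simp only [coeff_apply, RingHom.id_apply, AddMonoidHom.smul_apply]
        rw [← algebraMap_smul R a p, ← smul_comm, map_smul, algebraMap_smul] }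
  map_add' φ ψ := by ext; simp
  map_smul' a φ := by ext; simp

/-- Two-sided multiplication as a bilinear map. -/
def mulBothBilin : R →ₗ[A] R →ₗ[A] (R →+ R) where
  toFun a :=
    { toFun := fun c => mulBoth a c
      map_add' := fun p q => by ext b; exact mul_add _ _ _
      map_smul' := fun r p => by ext b; exact mul_smul_comm _ _ _ }
  map_add' φ ψ := by ext b c; exact (congrArg (· * b) (add_mul _ _ _)).trans (add_mul _ _ _)
  map_smul' a φ := by
    ext b c
    exact (congrArg (· * b) (smul_mul_assoc _ _ _)).trans (smul_mul_assoc _ _ _)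

/-- With `A` acting through the target, coefficients are bilinear in (φ, p) and multiplications in
(a, c), so the ring sits inside a finitely generated `A`-module `W`. The scalars `A` act by elements
of the ring itself, so its left ideals are `A`-submodules. -/
theorem isArtinianRing_coeffRing (A : Type*) [CommRing A] [IsArtinianRing A] [Algebra A R]
    [Module.Finite A R] [Module.Finite R P] {d : ℕ}
    (hP : BimoduleIso R (BalancedTensor R P P) (Fin d → P)) : IsArtinianRing (coeffRing hP) := by
  let _ : Module A P := Module.compHom P (algebraMap A R)
  have : IsScalarTower A R P := ⟨fun a r p => by
    rw [Algebra.smul_def, mul_smul]; rfl⟩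
  have : Module.Finite A P := Module.Finite.trans R P
  have : Module.Finite A (P →ₗ[R] R) := by
    obtain ⟨n, f, hf⟩ := Module.Finite.exists_fin' R P
    let κ : (P →ₗ[R] R) →ₗ[A] (Fin n → R) :=
      { toFun := fun φ i => φ (f (Pi.single i 1))
        map_add' := fun _ _ => rfl
        map_smul' := fun _ _ => rfl }
    refine Module.Finite.of_injective κ fun φ ψ h => ?_
    have h1 : φ ∘ₗ f = ψ ∘ₗ f :=
      LinearMap.pi_ext' fun i => LinearMap.ext_ring (congrFun h i)
    ext x
    obtain ⟨x, rfl⟩ := hf x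
    exact LinearMap.congr_fun h1 x
  let W : Submodule A (R →+ R) :=
    Submodule.map₂ (coeffBilin A (P := P)) ⊤ ⊤ ⊔ Submodule.map₂ (mulBothBilin A (R := R)) ⊤ ⊤
  have hW : W.FG := (Submodule.FG.map₂ _ Module.Finite.fg_top Module.Finite.fg_top).sup
    (Submodule.FG.map₂ _ Module.Finite.fg_top Module.Finite.fg_top)
  have hle : AddSubgroup.closure (coeffGen R P) ≤ W.toAddSubgroup := by
    refine (AddSubgroup.closure_le _).2 ?_
    rintro _ (⟨φ, p, rfl⟩ | ⟨a, c, rfl⟩)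
    · change (coeff φ p : R →+ R) ∈ W
      exact Submodule.mem_sup_left
        (Submodule.apply_mem_map₂ (coeffBilin A) (m := φ) (n := p) trivial trivial)
    · change mulBothBilin A (R := R) a c ∈ W
      refine Submodule.mem_sup_right
        (Submodule.apply_mem_map₂ (mulBothBilin A (R := R)) (m := a) (n := c) trivial trivial)
  let ι : A →+* coeffRing hP :=
    { toFun := fun a => ⟨mulBoth (algebraMap A R a) 1, mulBoth_mem P _ _⟩
      map_one' := Subtype.ext (by ext b; simp)
      map_zero' := Subtype.ext (by ext b; simp)
      map_add' := fun a a' => Subtype.ext (by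
        ext b
        change algebraMap A R (a + a') * b * 1 =
          algebraMap A R a * b * 1 + algebraMap A R a' * b * 1
        rw [map_add]; noncomm_ring)
      map_mul' := fun a a' => Subtype.ext (by
        ext b
        change algebraMap A R (a * a') * b * 1 = algebraMap A R a * (algebraMap A R a' * b * 1) * 1
        rw [map_mul]; noncomm_ring) }
  let _ : Module A (coeffRing hP) := Module.compHom _ ι
  have : IsScalarTower A (coeffRing hP) (coeffRing hP) := ⟨fun a x y => mul_assoc (ι a) x y⟩
  have : Module.Finite A W := Module.Finite.iff_fg.2 hW
  have hWa : IsArtinian A W := isArtinian_of_fg_of_artinian W hW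
  let j : coeffRing hP →ₗ[A] W :=
    { toFun := fun x => ⟨x.1, hle x.2⟩
      map_add' := fun _ _ => rfl
      map_smul' := fun a x => Subtype.ext (AddMonoidHom.ext fun b => by
        change algebraMap A R a * x.1 b * 1 = a • x.1 b
        rw [mul_one, Algebra.smul_def]) }
  have : IsArtinian A (coeffRing hP) := isArtinian_of_injective j fun x y h =>
    Subtype.ext (congrArg (fun w : W => (w : R →+ R)) h)
  exact isArtinian_of_tower A this

end Artinian

end CoeffRing

/-! ### The centre as commutant, and density of the coefficients. -/

section Density

variable {R : Type*} [Ring R] {P : Type*} [AddCommGroup P] [Module R P] [Module Rᵐᵒᵖ P]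
  [SMulCommClass R Rᵐᵒᵖ P] {d : ℕ}

/-- For every p, zbp = bpz = bzp, and a left free module of positive rank contains a vector with
zero annihilator. -/
theorem IsGalois.mul_comm_of_mem_center (hP : IsGalois R P d) {z : R}
    (hz : z ∈ bimoduleCenter R P) (b : R) : z * b = b * z := by
  obtain ⟨e⟩ := hP.free_left
  let p := e.symm (Pi.single ⟨0, hP.one_le⟩ 1)
  have h : (z * b) • p = (b * z) • p := by
    rw [mul_smul, hz, ← smul_comm, ← hz, mul_smul]
  simpa [p] using congrFun (congrArg e h) ⟨0, hP.one_le⟩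

theorem IsGalois.mem_center_of_forall (hP : IsGalois R P d) {z : R}
    (h : ∀ (φ : P →ₗ[R] R) (p : P), φ (z • p) = φ (op z • p)) : z ∈ bimoduleCenter R P := by
  obtain ⟨e⟩ := hP.free_left
  intro p
  apply e.injective
  ext i
  exact h (LinearMap.proj i ∘ₗ e.toLinearMap) p

theorem mem_center_of_mul_eq_one {z w : R} (hz : z ∈ bimoduleCenter R P) (hzw : z * w = 1)
    (hwz : w * z = 1) : w ∈ bimoduleCenter R P := by
  intro x
  have h1 : z • op w • x = x := by
    rw [smul_comm, hz, smul_smul, ← op_mul, hzw, op_one, one_smul]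
  have h2 := congrArg (w • ·) h1
  simpa [smul_smul, hwz] using h2.symm

/-- The action of the center on `R` commutes with the coefficients. -/
def centerMul (hP : IsGalois R P d) {z : R} (hz : z ∈ bimoduleCenter R P) :
    Module.End (coeffRing hP.tensor) R where
  toFun b := z * b
  map_add' := mul_add z
  map_smul' x b := by
    change z * x.1 b = x.1 (z * b)
    obtain ⟨x, hx⟩ := x
    change x ∈ AddSubgroup.closure (coeffGen R P) at hx
    induction hx using AddSubgroup.closure_induction with
    | mem x hx =>
      obtain ⟨φ, p, rfl⟩ | ⟨a, c, rfl⟩ := hx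
      · change z * φ (op b • p) = φ (op (z * b) • p)
        rw [op_mul, mul_smul, ← hz, ← smul_comm, φ.map_smul, smul_eq_mul]
      · change z * (a * b * c) = a * (z * b) * c
        rw [← mul_assoc, ← mul_assoc, hP.mul_comm_of_mem_center hz a, mul_assoc a]
    | zero => exact mul_zero z
    | add x y _ _ h h' => exact (mul_add _ _ _).trans (congrArg₂ (· + ·) h h')
    | neg x _ h => exact (mul_neg _ _).trans (congrArg (- ·) h)

variable (hP : IsGalois R P d)

/-- Commuting with right multiplications makes δ left multiplication by z = δ(1). Commuting with
coefficients then says φ(zp) = zφ(p) = φ(pz), and functionals separate points of `P`. -/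
theorem IsGalois.end_apply (δ : Module.End (coeffRing hP.tensor) R) :
    δ 1 ∈ bimoduleCenter R P ∧ ∀ b, δ b = δ 1 * b := by
  have h1 : ∀ b, δ b = δ 1 * b := fun b => by
    have := δ.map_smul (⟨mulBoth 1 b, mulBoth_mem P 1 b⟩ : coeffRing hP.tensor) 1
    change δ (1 * 1 * b) = 1 * δ 1 * b at this
    simpa using this
  have h2 : ∀ b, δ b = b * δ 1 := fun b => by
    have := δ.map_smul (⟨mulBoth b 1, mulBoth_mem P b 1⟩ : coeffRing hP.tensor) 1
    change δ (b * 1 * 1) = b * δ 1 * 1 at this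
    simpa using this
  refine ⟨hP.mem_center_of_forall fun φ p => ?_, h1⟩
  have := δ.map_smul (⟨coeff φ p, coeffSpan_le (AddSubgroup.subset_closure ⟨φ, p, rfl⟩)⟩ :
    coeffRing hP.tensor) 1
  change δ (φ (op 1 • p)) = φ (op (δ 1) • p) at this
  rw [← this, op_one, one_smul, h1 (φ p), φ.map_smul, smul_eq_mul]

/-- An additive subgroup of `R` that is a two-sided ideal and stable under all coefficients. -/
structure IsCoeffStable (R P : Type*) [Ring R] [AddCommGroup P] [Module R P] [Module Rᵐᵒᵖ P]
    (V : AddSubgroup R) : Prop where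
  mul_mem : ∀ a c, ∀ v ∈ V, a * v * c ∈ V
  coeff_mem : ∀ (φ : P →ₗ[R] R) p, ∀ v ∈ V, φ (op v • p) ∈ V

theorem IsGalois.isSimpleModule_coeffRing [Nontrivial R]
    (h : ∀ V : AddSubgroup R, IsCoeffStable R P V → V = ⊥ ∨ V = ⊤) :
    IsSimpleModule (coeffRing hP.tensor) R := by
  rw [isSimpleModule_iff]
  refine { eq_bot_or_eq_top := fun N => ?_ }
  refine (h N.toAddSubgroup ⟨fun a c v hv => ?_, fun φ p v hv => ?_⟩).imp (fun h => ?_) fun h => ?_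
  · exact N.smul_mem (⟨mulBoth a c, mulBoth_mem P a c⟩ : coeffRing hP.tensor) hv
  · exact N.smul_mem (⟨coeff φ p, coeffSpan_le (AddSubgroup.subset_closure ⟨φ, p, rfl⟩)⟩ :
      coeffRing hP.tensor) hv
  · exact Submodule.toAddSubgroup_injective h
  · exact Submodule.toAddSubgroup_injective h

/-- Schur's lemma: multiplication by a nonzero element of the centre is a nonzero endomorphism of a
simple module, hence bijective. -/
theorem IsGalois.isField_center (hP : IsGalois R P d) [Nontrivial R]
    (h : ∀ V : AddSubgroup R, IsCoeffStable R P V → V = ⊥ ∨ V = ⊤) :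
    IsField (bimoduleCenter R P) := by
  have := hP.isSimpleModule_coeffRing h
  refine ⟨⟨0, 1, zero_ne_one⟩, fun z w => Subtype.ext (hP.mul_comm_of_mem_center z.2 w),
    fun {z} hz => ?_⟩
  have h0 : centerMul hP z.2 ≠ 0 := fun h0 => hz <| Subtype.ext <| by
    simpa [centerMul] using LinearMap.congr_fun h0 1
  obtain ⟨w, hw⟩ := (LinearMap.bijective_of_ne_zero h0).2 1
  have hw : (z : R) * w = 1 := hw
  exact ⟨⟨w, mem_center_of_mul_eq_one z.2 hw (hP.mul_comm_of_mem_center z.2 w ▸ hw)⟩,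
    Subtype.ext hw⟩

theorem IsGalois.finite_end (A : Type*) [CommRing A] [IsArtinianRing A] [Algebra A R]
    [Module.Finite A R] [Nontrivial R]
    (h : ∀ V : AddSubgroup R, IsCoeffStable R P V → V = ⊥ ∨ V = ⊤) :
    Module.Finite (Module.End (coeffRing hP.tensor) R) R := by
  obtain ⟨e⟩ := hP.free_left
  have : Module.Finite R P := Module.Finite.equiv e.symm
  have := hP.isSimpleModule_coeffRing h
  have := isArtinianRing_coeffRing A hP.tensor
  exact finite_end_of_isSimpleModule (coeffRing hP.tensor) R

theorem IsGalois.finite_center (hP : IsGalois R P d) (A : Type*) [CommRing A] [IsArtinianRing A]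
    [Algebra A R] [Module.Finite A R] [Nontrivial R]
    (h : ∀ V : AddSubgroup R, IsCoeffStable R P V → V = ⊥ ∨ V = ⊤)
    (K : Type*) [Field K] [Algebra K R]
    (hK : ∀ z ∈ bimoduleCenter R P, ∃ k, algebraMap K R k = z) : Module.Finite K R := by
  obtain ⟨s, hs⟩ := (hP.finite_end A h).fg_top
  refine ⟨s, top_le_iff.1 fun b _ => ?_⟩
  have hb : b ∈ Submodule.span (Module.End (coeffRing hP.tensor) R) (s : Set R) := hs ▸ trivial
  induction hb using Submodule.span_induction with
  | mem x hx => exact Submodule.subset_span hx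
  | zero => exact Submodule.zero_mem _
  | add x y _ _ hx hy => exact Submodule.add_mem _ (hx trivial) (hy trivial)
  | smul δ x _ hx =>
    obtain ⟨h1, h2⟩ := hP.end_apply δ
    obtain ⟨k, hk⟩ := hK _ h1
    rw [Module.End.smul_def, h2, ← hk, ← Algebra.smul_def]
    exact Submodule.smul_mem _ _ (hx trivial)

/-- Double centralizer theorem: `R` is finite over the commutant of the coefficient ring, and that
commutant acts by scalars from `K`, so every `K`-linear map lies in the ring. -/
theorem IsGalois.mem_closure_coeffGen (hP : IsGalois R P d) (A : Type*) [CommRing A]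
    [IsArtinianRing A] [Algebra A R] [Module.Finite A R] [Nontrivial R]
    (h : ∀ V : AddSubgroup R, IsCoeffStable R P V → V = ⊥ ∨ V = ⊤)
    (K : Type*) [Field K] [Algebra K R]
    (hK : ∀ z ∈ bimoduleCenter R P, ∃ k, algebraMap K R k = z) (T : R →ₗ[K] R) :
    T.toAddMonoidHom ∈ AddSubgroup.closure (coeffGen R P) := by
  have := hP.isSimpleModule_coeffRing h
  have := hP.finite_end A h
  let f : Module.End (Module.End (coeffRing hP.tensor) R) R :=
    { toFun := T
      map_add' := map_add T
      map_smul' := fun δ x => by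
        obtain ⟨h1, h2⟩ := hP.end_apply δ
        obtain ⟨k, hk⟩ := hK _ h1
        rw [RingHom.id_apply, Module.End.smul_def, Module.End.smul_def, h2, h2 (T x), ← hk,
          ← Algebra.smul_def, ← Algebra.smul_def, map_smul] }
  obtain ⟨x, hx⟩ := Module.Finite.toModuleEnd_moduleEnd_surjective (R := coeffRing hP.tensor) f
  have : T.toAddMonoidHom = x.1 := AddMonoidHom.ext fun b => (LinearMap.congr_fun hx b).symm
  rw [this]
  exact x.2

/-- The span is an ideal, so rank-one maps suffice. The map b ↦ f(b)a is b ↦ f(b)1, followed by a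
coefficient fixing the scalars `K`, followed by multiplication by a. -/
theorem IsGalois.mem_coeffSpan (hP : IsGalois R P d) (A : Type*) [CommRing A]
    [IsArtinianRing A] [Algebra A R] [Module.Finite A R] [Nontrivial R]
    (h : ∀ V : AddSubgroup R, IsCoeffStable R P V → V = ⊥ ∨ V = ⊤)
    (K : Type*) [Field K] [Algebra K R] [FiniteDimensional K R] [IsCentralOver K R P]
    (hK : ∀ z ∈ bimoduleCenter R P, ∃ k, algebraMap K R k = z) (T : R →ₗ[K] R) :
    T.toAddMonoidHom ∈ coeffSpan R P := by
  obtain ⟨e⟩ := hP.free_left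
  induction T using endo_induction with
  | h0 => exact AddSubgroup.zero_mem _
  | ha S T hS hT => exact AddSubgroup.add_mem _ hS hT
  | h f a =>
    have h1 := hP.mem_closure_coeffGen A h K hK (dualTensorHom K R R (f ⊗ₜ 1))
    have h2 : coeff (LinearMap.proj ⟨0, hP.one_le⟩ ∘ₗ e.toLinearMap)
        (e.symm (Pi.single ⟨0, hP.one_le⟩ 1)) ∈ coeffSpan R P :=
      AddSubgroup.subset_closure ⟨_, _, rfl⟩
    have h3 := mul_mem_coeffSpan (mulBoth_mem P a 1) h2 h1 hP.tensor
    refine (congrArg (· ∈ coeffSpan R P) (AddMonoidHom.ext fun b => ?_)).mpr h3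
    change f b • a = a * (e (op (f b • (1 : R)) • e.symm (Pi.single ⟨0, hP.one_le⟩ 1))
      ⟨0, hP.one_le⟩) * 1
    rw [← Algebra.algebraMap_eq_smul_one, ← IsCentralOver.smul_comm, map_smul, e.apply_symm_apply]
    simp [Algebra.smul_def, Algebra.commutes]

end Density

/-! ### Commuting central simple subalgebras and dimension counts. -/

section CentralSimple

variable {L B : Type*} [Field L] [Ring B] [Algebra L B] [Algebra.IsCentral L B] [IsSimpleRing B]
  [FiniteDimensional L B]

variable (L B) in
/-- Every linear endomorphism of a central simple algebra is a sum of two-sided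
multiplications. -/
theorem mulLeftRight_surjective : Function.Surjective (AlgHom.mulLeftRight L B) := by
  let D := (AlgHom.mulLeftRight L B).range
  have hmem : ∀ a c, AlgHom.mulLeftRight L B (a ⊗ₜ op c) ∈ D := fun a c => ⟨_, rfl⟩
  -- Double centralizer again: `B` is simple over its two-sided multiplications, and their commutant
  -- is `L`.
  have : IsSimpleModule D B := by
    rw [isSimpleModule_iff]
    refine { eq_bot_or_eq_top := fun N => ?_ }
    have hN : ∀ a c, ∀ v ∈ N, a * v * c ∈ N := fun a c v hv => by
      have := N.smul_mem (⟨_, hmem a c⟩ : D) hv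
      rwa [Subalgebra.smul_def, Module.End.smul_def, AlgHom.mulLeftRight_apply, unop_op] at this
    let J : TwoSidedIdeal B := TwoSidedIdeal.mk' N N.zero_mem N.add_mem 
      (fun {x} hx => by simpa using hN (-1) 1 x hx)
      (fun {x y} hy => by simpa using hN x 1 y hy) (fun {x y} hx => by simpa using hN 1 y x hx)
    have hJ : ∀ x, x ∈ J ↔ x ∈ N := fun x => TwoSidedIdeal.mem_mk' _ _ _ _ _ _ x
    refine (IsSimpleRing.simple.eq_bot_or_eq_top J).imp (fun h => ?_) fun h => ?_
    · refine (Submodule.eq_bot_iff N).2 fun x hx => ?_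
      rw [← hJ, h] at hx
      exact hx
    · refine (Submodule.eq_top_iff').2 fun x => ?_
      rw [← hJ, h]
      trivial
  have hend : ∀ (δ : Module.End D B), ∃ l : L, ∀ b, δ b = l • b := fun δ => by
    have h1 : ∀ a c b, δ (a * b * c) = a * δ b * c := fun a c b => by
      have := δ.map_smul (⟨_, hmem a c⟩ : D) b
      simpa only [Subalgebra.smul_def, Module.End.smul_def, AlgHom.mulLeftRight_apply, unop_op]
        using this
    have h2 : ∀ b, δ b = δ 1 * b := fun b => by simpa using h1 1 b 1
    have h3 : ∀ b, δ b = b * δ 1 := fun b => by simpa using h1 b 1 1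
    have h4 : δ 1 ∈ Subalgebra.center L B :=
      Subalgebra.mem_center_iff.2 fun b => (h3 b).symm.trans (h2 b)
    rw [Algebra.IsCentral.center_eq_bot] at h4
    obtain ⟨l, hl⟩ := h4
    have hl : algebraMap L B l = δ 1 := hl
    exact ⟨l, fun b => by rw [h2, ← hl, Algebra.smul_def]⟩
  have : Module.Finite (Module.End D B) B := by
    obtain ⟨s, hs⟩ := Module.Finite.fg_top (R := L) (M := B)
    refine ⟨s, top_le_iff.1 fun b _ => ?_⟩
    have hb : b ∈ Submodule.span L (s : Set B) := hs ▸ trivial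
    induction hb using Submodule.span_induction with
    | mem x hx => exact Submodule.subset_span hx
    | zero => exact Submodule.zero_mem _
    | add x y _ _ hx hy => exact Submodule.add_mem _ (hx trivial) (hy trivial)
    | smul l x _ hx =>
      let δ : Module.End D B :=
        { toFun := fun y => l • y
          map_add' := smul_add l
          map_smul' := fun t y => (t.1.map_smul l y).symm }
      exact Submodule.smul_mem _ δ (hx trivial)
  intro T
  let f : Module.End (Module.End D B) B :=
    { toFun := T
      map_add' := map_add T
      map_smul' := fun δ x => by
        obtain ⟨l, hl⟩ := hend δ
        rw [RingHom.id_apply, Module.End.smul_def, Module.End.smul_def, hl, hl, map_smul] }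
  obtain ⟨⟨x, t, rfl⟩, hx⟩ := Module.Finite.toModuleEnd_moduleEnd_surjective (R := D) f
  exact ⟨t, LinearMap.ext fun b => LinearMap.congr_fun hx b⟩

variable {Γ : Type*} [Ring Γ]

/-- A basis of a central simple subalgebra is linearly independent over its centralizer. -/
theorem eq_zero_of_sum_mul_eq_zero (β : B →+* Γ) {κ : Type*} [Fintype κ] (b : Module.Basis κ L B)
    (x : κ → Γ) (hx : ∀ i a, x i * β a = β a * x i) (h : ∑ i, β (b i) * x i = 0) (j : κ) :
    x j = 0 := by
  classical
  -- Because the `x i` centralize `B`, the relation survives any two-sided multiplication applied to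
  -- the basis; one of these sends `b j` to 1 and the other basis vectors to 0.
  have key : ∀ t, ∑ i, β (AlgHom.mulLeftRight L B t (b i)) * x i = 0 := fun t => by
    induction t with
    | zero => simp
    | tmul a c =>
      have : ∀ i, β (AlgHom.mulLeftRight L B (a ⊗ₜ c) (b i)) * x i =
          β a * (β (b i) * x i) * β (unop c) := fun i => by
        rw [AlgHom.mulLeftRight_apply, map_mul, map_mul, mul_assoc (β a * β (b i)), ← hx]
        simp only [mul_assoc]
      simp only [this, ← Finset.sum_mul, ← Finset.mul_sum, h, mul_zero, zero_mul]
    | add s t hs ht =>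
      simp only [map_add, LinearMap.add_apply, add_mul, Finset.sum_add_distrib, hs, ht, add_zero]
  obtain ⟨t, ht⟩ := mulLeftRight_surjective L B (b.constr L (fun i => if i = j then 1 else 0))
  have := key t
  rw [ht] at this
  simpa [ite_mul, apply_ite β] using this

variable {L' B' : Type*} [Field L'] [Ring B'] [Algebra L' B'] [Algebra.IsCentral L' B']
  [IsSimpleRing B'] [FiniteDimensional L' B']

/-- An algebra generated by two commuting central simple subalgebras whose centers consist of
scalars. -/
theorem finrank_eq_of_commuting {F : Type*} [Field F] [Algebra F Γ] [Nontrivial Γ]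
    (β : B →+* Γ) (β' : B' →+* Γ) (hc : ∀ b b', β b * β' b' = β' b' * β b)
    (hL : ∀ l, ∃ f, algebraMap F Γ f = β (algebraMap L B l))
    (hL' : ∀ l, ∃ f, algebraMap F Γ f = β' (algebraMap L' B' l))
    (hs : Submodule.span F (Set.range fun p : B × B' => β p.1 * β' p.2) = ⊤) :
    Module.Finite F Γ ∧ Module.finrank F Γ = Module.finrank L B * Module.finrank L' B' := by
  let b := Module.finBasis L B
  let b' := Module.finBasis L' B'
  let v : Fin (Module.finrank L B) × Fin (Module.finrank L' B') → Γ := fun p =>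
    β (b p.1) * β' (b' p.2)
  -- Independence is used twice: over `B` with coefficients from the image of `B'`, which centralize
  -- `B`, then over `B'` with scalar coefficients.
  have hv : LinearIndependent F v := by
    refine Fintype.linearIndependent_iff.2 fun g hg p => ?_
    have h1 := eq_zero_of_sum_mul_eq_zero β b (fun i => ∑ j, β' (b' j) * algebraMap F Γ (g (i, j)))
      (fun i a => by
        rw [Finset.sum_mul, Finset.mul_sum]
        refine Finset.sum_congr rfl fun j _ => ?_
        rw [mul_assoc, Algebra.commutes, ← mul_assoc, ← hc, mul_assoc])
      (by
        rw [← hg, Fintype.sum_prod_type]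
        refine Finset.sum_congr rfl fun i _ => ?_
        rw [Finset.mul_sum]
        refine Finset.sum_congr rfl fun j _ => ?_
        rw [Algebra.smul_def, Algebra.commutes, ← mul_assoc]) p.1
    have h2 := eq_zero_of_sum_mul_eq_zero β' b' (fun j => algebraMap F Γ (g (p.1, j)))
      (fun j a => Algebra.commutes _ _) h1 p.2
    exact (map_eq_zero_iff _ (algebraMap F Γ).injective).1 h2
  choose f hf using hL
  choose f' hf' using hL'
  have hb : ∀ x, β x = ∑ i, f (b.repr x i) • β (b i) := fun x => by
    conv_lhs => rw [← b.sum_repr x, map_sum]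
    exact Finset.sum_congr rfl fun i _ => by rw [Algebra.smul_def, map_mul, ← hf, Algebra.smul_def]
  have hb' : ∀ x, β' x = ∑ i, f' (b'.repr x i) • β' (b' i) := fun x => by
    conv_lhs => rw [← b'.sum_repr x, map_sum]
    exact Finset.sum_congr rfl fun i _ => by rw [Algebra.smul_def, map_mul, ← hf', Algebra.smul_def]
  have hsp : ⊤ ≤ Submodule.span F (Set.range v) := by
    rw [← hs]
    refine Submodule.span_le.2 ?_
    rintro _ ⟨⟨x, y⟩, rfl⟩
    change β x * β' y ∈ Submodule.span F (Set.range v)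
    rw [hb, hb', Finset.sum_mul_sum]
    refine Submodule.sum_mem _ fun i _ => Submodule.sum_mem _ fun j _ => ?_
    rw [smul_mul_smul_comm]
    exact Submodule.smul_mem _ _ (Submodule.subset_span ⟨(i, j), rfl⟩)
  let w := Module.Basis.mk hv hsp
  refine ⟨Module.Finite.of_basis w, ?_⟩
  rw [Module.finrank_eq_card_basis w]
  simp

end CentralSimple

section Density

variable (D S : Type*) [DivisionRing D] [AddCommGroup S] [Module D S] [Module.Finite D S]

/-- The dimension of an endomorphism algebra over the center of the division ring. -/
theorem exists_finrank_end_eq [Module.Finite (Subring.center D) (Module.End D S)] :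
    ∃ t, Module.finrank (Subring.center D) (Module.End D S) = Module.finrank D S ^ 2 * t := by
  let b := Module.finBasis D S
  -- With n the dimension of `S` over `D`, the endomorphism ring is `S ^ n` over the centre of `D`,
  -- whence n² [D : Z(D)].
  let e := b.constr (Subring.center D) (M' := S)
  refine ⟨Module.finrank (Subring.center D) D, ?_⟩
  rcases Nat.eq_zero_or_pos (Module.finrank D S) with h0 | h0
  · have : Subsingleton S := Module.finrank_zero_iff.1 h0
    rw [h0, Module.finrank_zero_of_subsingleton]
    simp
  have : Module.Finite (Subring.center D) (Fin (Module.finrank D S) → S) :=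
    Module.Finite.equiv e.symm
  have : Module.Finite (Subring.center D) S :=
    Module.Finite.of_surjective (LinearMap.proj (R := Subring.center D)
      (φ := fun _ : Fin (Module.finrank D S) => S) ⟨0, h0⟩) (Function.surjective_eval _)
  rw [← e.finrank_eq, Module.finrank_pi_fintype, Finset.sum_const, Finset.card_univ,
    Fintype.card_fin, ← Module.finrank_mul_finrank (Subring.center D) D S, smul_eq_mul]
  ring

end Density

section Density

/-- A generating pair of commuting central simple subalgebras in the endomorphism ring of a vector
space over a division ring. -/
theorem finrank_sq_dvd {D S : Type*} [DivisionRing D] [AddCommGroup S] [Module D S]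
    [Module.Finite D S] [Nontrivial S] {L B : Type*} [Field L] [Ring B] [Algebra L B]
    [Algebra.IsCentral L B] [IsSimpleRing B] [FiniteDimensional L B]
    {L' B' : Type*} [Field L'] [Ring B'] [Algebra L' B'] [Algebra.IsCentral L' B']
    [IsSimpleRing B'] [FiniteDimensional L' B']
    (β : B →+* Module.End D S) (β' : B' →+* Module.End D S)
    (hc : ∀ b b', β b * β' b' = β' b' * β b)
    (hL : ∀ l, ∃ f ∈ Subring.center D, ∀ s, β (algebraMap L B l) s = f • s)
    (hL' : ∀ l, ∃ f ∈ Subring.center D, ∀ s, β' (algebraMap L' B' l) s = f • s)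
    (hs : AddSubgroup.closure (Set.range fun p : B × B' => β p.1 * β' p.2) = ⊤) :
    Module.finrank D S ^ 2 ∣ Module.finrank L B * Module.finrank L' B' := by
  let F := Subring.center D
  obtain ⟨hf, hd⟩ := finrank_eq_of_commuting (F := F) β β' hc
    (fun l => by
      obtain ⟨f, hf, h⟩ := hL l
      exact ⟨⟨f, hf⟩, LinearMap.ext fun s => (h s).symm⟩)
    (fun l => by
      obtain ⟨f, hf, h⟩ := hL' l
      exact ⟨⟨f, hf⟩, LinearMap.ext fun s => (h s).symm⟩)
    (by
      refine (Submodule.eq_top_iff').2 fun γ => ?_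
      have h1 : AddSubgroup.closure (Set.range fun p : B × B' => β p.1 * β' p.2) ≤
          (Submodule.span F (Set.range fun p : B × B' => β p.1 * β' p.2)).toAddSubgroup :=
        (AddSubgroup.closure_le _).2 Submodule.subset_span
      exact h1 (hs ▸ trivial))
  obtain ⟨t, ht⟩ := exists_finrank_end_eq D S
  exact ⟨t, hd.symm.trans ht⟩

end Density

/-! ### Simple bimodules supported on a pair of factors. -/

section Corner

/-- `B` is a direct factor of the ring `R` through the ring homomorphism `σ`, which does not
preserve units. -/
structure IsFactor {B R : Type*} [Ring B] [Ring R] (σ : B →ₙ+* R) : Prop where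
  injective : Function.Injective σ
  comm : ∀ r, σ 1 * r = r * σ 1
  surj : ∀ r, ∃ b, σ b = σ 1 * r

theorem IsFactor.commute {B R : Type*} [Ring B] [Ring R] {σ : B →ₙ+* R} (h : IsFactor σ) {z : B}
    (hz : ∀ b, z * b = b * z) (r : R) : σ z * r = r * σ z := by
  obtain ⟨b, hb⟩ := h.surj r
  calc σ z * r = σ (z * 1) * r := by rw [mul_one]
    _ = σ z * σ b := by rw [map_mul, mul_assoc, hb]
    _ = σ b * σ z := by rw [← map_mul, hz, map_mul]
    _ = r * σ (1 * z) := by rw [hb, h.comm, mul_assoc, map_mul]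
    _ = r * σ z := by rw [one_mul]

variable (K : Type*) [Field K] (R : Type*) [Ring R] [Algebra K R]

theorem Env.add_mk (a a' b : R) : mk K R (a + a') b = mk K R a b + mk K R a' b :=
  TensorProduct.add_tmul _ _ _

theorem Env.mk_add (a b b' : R) : mk K R a (b + b') = mk K R a b + mk K R a b' :=
  TensorProduct.tmul_add _ _ _

theorem Env.zero_mk (b : R) : mk K R 0 b = 0 := TensorProduct.zero_tmul _ _

theorem Env.mk_zero (a : R) : mk K R a 0 = 0 := TensorProduct.tmul_zero _ _

variable {R} in
theorem Env.mk_ne_zero {a b : R} (ha : a ≠ 0) (hb : b ≠ 0) : mk K R a b ≠ 0 := by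
  intro h
  obtain ⟨f, hf⟩ := Module.Projective.exists_dual_ne_zero K ha
  obtain ⟨g, hg⟩ := Module.Projective.exists_dual_ne_zero K (x := op b) (by simpa using hb)
  have h1 : LinearMap.mul' K K (TensorProduct.map f g (a ⊗ₜ op b)) = LinearMap.mul' K K
    (TensorProduct.map f g 0) := congrArg (fun t => LinearMap.mul' K K (TensorProduct.map f g t)) h
  simp [hf, hg] at h1

variable {K R}
variable {B : Type*} [Ring B] {B' : Type*} [Ring B'] {σ : B →ₙ+* R} {σ' : B' →ₙ+* R}

theorem IsFactor.mk_comm (hσ : IsFactor σ) (hσ' : IsFactor σ') {z : B} {z' : B'}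
    (hz : ∀ b, z * b = b * z) (hz' : ∀ b, z' * b = b * z') (t : Env K R) :
    Env.mk K R (σ z) (σ' z') * t = t * Env.mk K R (σ z) (σ' z') := by
  induction t using Env.induction_on with
  | h0 => rw [mul_zero, zero_mul]
  | ht a b => rw [Env.mk_mul_mk, Env.mk_mul_mk, hσ.commute hz, hσ'.commute hz']
  | ha s t hs ht => rw [mul_add, add_mul, hs, ht]

variable (K) in
/-- There is a simple module over the enveloping algebra on which two given factors act
unitally. -/
theorem IsFactor.exists_simple (hσ : IsFactor σ) (hσ' : IsFactor σ') [Nontrivial B]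
    [Nontrivial B'] :
    ∃ I : Submodule (Env K R) (Env K R), IsSimpleModule (Env K R) (Env K R ⧸ I) ∧
      ∀ s : Env K R ⧸ I, Env.mk K R (σ 1) (σ' 1) • s = s := by
  set g := Env.mk K R (σ 1) (σ' 1) with hg
  have hgc : ∀ t, g * t = t * g :=
    hσ.mk_comm hσ' (fun b => (Commute.one_left b)) (fun b => Commute.one_left b)
  have hgg : g * g = g := by
    rw [hg, Env.mk_mul_mk, ← map_mul, ← map_mul, mul_one, mul_one]
  have hg0 : g ≠ 0 := Env.mk_ne_zero K
    (fun h => one_ne_zero (hσ.injective (h.trans (map_zero σ).symm)))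
    (fun h => one_ne_zero (hσ'.injective (h.trans (map_zero σ').symm)))
  -- The left ideal generated by `1 - g` is killed by right multiplication with `g ≠ 0`, hence lies
  -- in a maximal one; on the quotient `g` acts as 1.
  have htop : Submodule.span (Env K R) {1 - g} ≠ ⊤ := fun h => by
    have h1 : g ∈ Submodule.span (Env K R) {1 - g} := h ▸ trivial
    obtain ⟨x, hx⟩ := Submodule.mem_span_singleton.1 h1
    refine hg0 ?_
    rw [← hgg]
    nth_rewrite 1 [← hx]
    rw [smul_eq_mul, mul_assoc, sub_mul, one_mul, hgg, sub_self, mul_zero]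
  obtain ⟨I, hI, hle⟩ := (eq_top_or_exists_le_coatom _).resolve_left htop
  refine ⟨I, isSimpleModule_iff_isCoatom.2 hI, fun s => ?_⟩
  obtain ⟨x, rfl⟩ := I.mkQ_surjective s
  rw [← map_smul, ← sub_eq_zero, ← map_sub, Submodule.mkQ_apply, Submodule.Quotient.mk_eq_zero]
  refine hle (Submodule.mem_span_singleton.2 ⟨-x, ?_⟩)
  rw [smul_eq_mul, smul_eq_mul, hgc, mul_sub, mul_one, neg_mul]
  abel

variable {L L' : Type*} [Field L] [Algebra L B] [Algebra.IsCentral L B] [IsSimpleRing B]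
  [FiniteDimensional L B] [Field L'] [Algebra L' B'] [Algebra.IsCentral L' B'] [IsSimpleRing B']
  [FiniteDimensional L' B'] [FiniteDimensional K R]

variable (K L L') in
-- On a simple module `S` where both factors act unitally, with endomorphism ring `D`, density makes
-- End_D(S) generated by commuting images of `B` and B'ᵒᵖ, whose centres act through Z(D). Its
-- dimension over Z(D) is thus [B : L][B' : L'], and it is also a multiple of (dim_D S)².
theorem IsFactor.exists_dvd (hσ : IsFactor σ) (hσ' : IsFactor σ') :
    ∃ I : Submodule (Env K R) (Env K R), IsSimpleModule (Env K R) (Env K R ⧸ I) ∧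
      bimodRank K R (Env K R ⧸ I) (RegBimod K R) ^ 2 ∣
        Module.finrank L B * Module.finrank L' B' := by
  classical
  obtain ⟨I, hI, hu⟩ := hσ.exists_simple K hσ'
  refine ⟨I, hI, ?_⟩
  rw [bimodRank_regBimod, projRank_self]
  let E := Env K R
  let S := E ⧸ I
  let D := Module.End E S
  have hfin : Module.Finite D S := finite_end_of_isSimpleModule E S
  have hnt : Nontrivial S := IsSimpleModule.nontrivial E S
  let Γ := Module.End D S
  let ρ : E →+* Γ := Module.toModuleEnd D (S := E) S
  have hρ : ∀ t s, ρ t s = t • s := fun _ _ => rfl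
  have hρs : Function.Surjective ρ := Module.Finite.toModuleEnd_moduleEnd_surjective
  have hg : ρ (Env.mk K R (σ 1) (σ' 1)) = 1 := LinearMap.ext hu
  have h1 : ρ (Env.mk K R (σ 1) 1) = 1 := by
    rw [← mul_one (ρ _), ← hg, ← map_mul, Env.mk_mul_mk, ← map_mul, mul_one, mul_one]
  have h2 : ρ (Env.mk K R 1 (σ' 1)) = 1 := by
    rw [← mul_one (ρ _), ← hg, ← map_mul, Env.mk_mul_mk, ← map_mul, mul_one, one_mul]
  let β : B →+* Γ :=
    { toFun := fun b => ρ (Env.mk K R (σ b) 1)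
      map_one' := h1
      map_mul' := fun b c => by rw [← map_mul, Env.mk_mul_mk, map_mul, mul_one]
      map_zero' := by rw [map_zero, Env.zero_mk, map_zero]
      map_add' := fun b c => by rw [map_add, Env.add_mk, map_add] }
  let β' : B'ᵐᵒᵖ →+* Γ :=
    { toFun := fun b => ρ (Env.mk K R 1 (σ' (unop b)))
      map_one' := h2
      map_mul' := fun b c => by rw [← map_mul, Env.mk_mul_mk, unop_mul, map_mul, mul_one]
      map_zero' := by rw [unop_zero, map_zero, Env.mk_zero, map_zero]
      map_add' := fun b c => by rw [unop_add, map_add, Env.mk_add, map_add] }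
  have hcen : ∀ t : E, (∀ u, t * u = u * t) → ∃ f ∈ Subring.center D, ∀ s, ρ t s = f • s :=
    fun t ht => by
    let δ : D :=
      { toFun := fun s => t • s
        map_add' := smul_add t
        map_smul' := fun u s => by rw [smul_smul, ht, mul_smul]; rfl }
    exact ⟨δ, Subring.mem_center_iff.2 fun γ => LinearMap.ext fun s => γ.map_smul t s,
      fun s => rfl⟩
  have hL : ∀ l, ∃ f ∈ Subring.center D, ∀ s, β (algebraMap L B l) s = f • s := fun l => by
    have h := hcen (Env.mk K R (σ (algebraMap L B l)) (σ' 1))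
      (hσ.mk_comm hσ' (Algebra.commutes l) (Commute.one_left))
    rw [Env.mk_eq_mul, map_mul, h2, mul_one] at h
    exact h
  have hL' : ∀ l, ∃ f ∈ Subring.center D, ∀ s, β' (algebraMap L' B'ᵐᵒᵖ l) s = f • s := fun l => by
    have h := hcen (Env.mk K R (σ 1) (σ' (algebraMap L' B' l)))
      (hσ.mk_comm hσ' (Commute.one_left) (Algebra.commutes l))
    rw [Env.mk_eq_mul, map_mul, h1, one_mul] at h
    exact h
  have hc : ∀ b b', β b * β' b' = β' b' * β b := fun b b' => by
    change ρ _ * ρ _ = ρ _ * ρ _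
    rw [← map_mul, ← map_mul, Env.mk_mul_mk, Env.mk_mul_mk]
    simp
  have hs : AddSubgroup.closure (Set.range fun p : B × B'ᵐᵒᵖ => β p.1 * β' p.2) = ⊤ := by
    refine (AddSubgroup.eq_top_iff' _).2 fun γ => ?_
    obtain ⟨t, rfl⟩ := hρs γ
    induction t using Env.induction_on with
    | h0 => rw [map_zero]; exact AddSubgroup.zero_mem _
    | ht a b =>
      obtain ⟨x, hx⟩ := hσ.surj a
      obtain ⟨y, hy⟩ := hσ'.surj b
      refine AddSubgroup.subset_closure ⟨(x, op y), ?_⟩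
      change ρ _ * ρ (Env.mk K R 1 (σ' y)) = _
      rw [← map_mul, Env.mk_mul_mk, hx, hy, mul_one, mul_one, hσ'.comm, ← Env.mk_mul_mk, map_mul,
        hg, one_mul]
    | ha s t hs ht => rw [map_add]; exact AddSubgroup.add_mem _ hs ht
  rw [← (MulOpposite.finrank : Module.finrank L' B'ᵐᵒᵖ = Module.finrank L' B')]
  exact finrank_sq_dvd β β' hc hL hL' hs

end Corner

/-! ### Descent to the centre and assembly. -/

section Balanced

variable {K : Type*} [Field K] {R : Type*} [Ring R] [Algebra K R]

/-- The bimodule `R ⊗_Z R` is the regular bimodule of the enveloping algebra over `Z`. -/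
theorem bimoduleIso_regBimod_balanced (Z : Subring R)
    (hZ : ∀ z : R, z ∈ Z ↔ ∃ k, algebraMap K R k = z) :
    BimoduleIso R (RegBimod K R) (BalancedTensor Z R R) := by
  have hZ' : ∀ k, algebraMap K R k ∈ Z := fun k => (hZ _).2 ⟨k, rfl⟩
  let g : BalancedTensor Z R R →+ Env K R := BalancedTensor.lift
    (AddMonoidHom.mk' (fun x => AddMonoidHom.mk' (Env.mk K R x) (Env.mk_add K R x)) fun x x' =>
      AddMonoidHom.ext fun y => Env.add_mk K R x x' y) fun z x y => by
        obtain ⟨k, hk⟩ := (hZ _).1 z.2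
        change Env.mk K R (x * z) y = Env.mk K R x (z * y)
        rw [← hk, ← Algebra.commutes, ← Algebra.smul_def, ← Algebra.smul_def]
        exact TensorProduct.smul_tmul k x (op y)
  let f : Env K R →+ BalancedTensor Z R R := TensorProduct.liftAddHom
    (AddMonoidHom.mk' (fun x : R => AddMonoidHom.mk'
      (fun y : Rᵐᵒᵖ => BalancedTensor.tmul Z x (unop y))
      fun y y' => BalancedTensor.tmul_add x _ _) fun x x' =>
      AddMonoidHom.ext fun y => BalancedTensor.add_tmul x x' _) fun k x y => by
        change BalancedTensor.tmul Z (k • x) (unop y) = BalancedTensor.tmul Z x (k • unop y)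
        rw [Algebra.smul_def, Algebra.commutes, Algebra.smul_def]
        exact BalancedTensor.smul_tmul (⟨_, hZ' k⟩ : Z) x (unop y)
  have hf : ∀ a b, f (Env.mk K R a b) = BalancedTensor.tmul Z a b := fun a b => rfl
  have hg : ∀ a b, g (BalancedTensor.tmul Z a b) = Env.mk K R a b := fun a b => rfl
  refine BimoduleIso.of_inverse (f : RegBimod K R →+ _) g (fun t => ?_) (fun t => ?_)
    (fun r t => ?_) (fun r t => ?_)
  · change Env K R at t
    change g (f t) = t
    induction t using Env.induction_on with
    | h0 => rw [map_zero, map_zero]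
    | ht a b => rw [hf, hg]
    | ha s t hs ht => rw [map_add, map_add, hs, ht]
  · change f (g t) = t
    induction t using BalancedTensor.induction_on with
    | h0 => rw [map_zero, map_zero]
    | ht a b => rw [hg, hf]
    | ha s t hs ht => rw [map_add, map_add, hs, ht]
  · change Env K R at t
    change f (Env.mk K R r 1 * t) = r • f t
    induction t using Env.induction_on with
    | h0 => rw [mul_zero, map_zero, smul_zero]
    | ht a b => rw [Env.mk_mul_mk, hf, hf, mul_one]; rfl
    | ha s t hs ht => rw [mul_add, map_add, map_add, hs, ht, smul_add]
  · change Env K R at t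
    change f (Env.mk K R 1 r * t) = op r • f t
    induction t using Env.induction_on with
    | h0 => rw [mul_zero, map_zero, smul_zero]
    | ht a b => rw [Env.mk_mul_mk, hf, hf, one_mul]; rfl
    | ha s t hs ht => rw [mul_add, map_add, map_add, hs, ht, smul_add]

end Balanced

section Main

universe u

variable {R : Type u} [Ring R] {P : Type*} [AddCommGroup P] [Module R P] [Module Rᵐᵒᵖ P]
  [SMulCommClass R Rᵐᵒᵖ P] {d : ℕ}

/-- Sufficiently many copies of a Galois bimodule form a multiple of the regular bimodule, provided
that the coefficients span all linear endomorphisms. -/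
theorem IsGalois.bimoduleIso_pi_regBimod (hP : IsGalois R P d) [IsSemisimpleRing R] [Nontrivial R]
    (K : Type*) [Field K] [Algebra K R] [FiniteDimensional K R] [IsCentralOver K R P]
    (hX : ∀ T : R →ₗ[K] R, T.toAddMonoidHom ∈ coeffSpan R P) {M : ℕ} (hM : 0 < M)
    (hdvd : ∀ N, (∀ I : Submodule (Env K R) (Env K R), IsSimpleModule (Env K R) (Env K R ⧸ I) →
      N ∣ d * bimodRank K R (Env K R ⧸ I) (RegBimod K R)) → N ∣ d * M) :
    ∃ r : ℕ, 0 < r ∧ BimoduleIso R (Fin M → P) (Fin r → RegBimod K R) := by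
  obtain ⟨hd, ⟨el⟩, ⟨er⟩, ht⟩ := hP
  have : Module.Finite R P := Module.Finite.equiv el.symm
  have hN := finrank_mul_bimodRank (K := K) el er ht (bimodRank_pos hX)
  have hN0 : 0 < Module.finrank K R := Module.finrank_pos
  -- The exponent is r = dM / [R : K], as comparing left ranks forces; integrality is exactly the
  -- divisibility hypothesis.
  obtain ⟨r, hr⟩ := hdvd (Module.finrank K R) fun I hI => ⟨_, (hN I hI).symm⟩
  refine ⟨r, Nat.pos_of_ne_zero fun h0 => ?_, GaloisBimodule.bimoduleIso_pi_regBimod el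
    (by rw [mul_comm, hr, mul_comm]) fun I hI => Nat.le_of_mul_le_mul_left (le_of_eq ?_) hN0⟩
  · rw [h0, mul_zero] at hr
    exact (Nat.mul_pos hd hM).ne' hr
  · rw [← mul_assoc, ← hr, mul_left_comm _ M, hN I hI]
    ring

/-- Here the ground field is the centre of `P` itself. Its field structure appears only inside the
proof, so `hdvd` ranges over all `K`, and `A` provides finiteness before the centre is known to be a
field. -/
theorem IsGalois.isField_and_bimoduleIso (hP : IsGalois R P d) (A : Type*) [CommRing A]
    [IsArtinianRing A] [Algebra A R] [Module.Finite A R] [IsSemisimpleRing R] [Nontrivial R]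
    (h : ∀ V : AddSubgroup R, IsCoeffStable R P V → V = ⊥ ∨ V = ⊤) {M : ℕ} (hM : 0 < M)
    (hdvd : ∀ (K : Type u) [Field K] [Algebra K R] [FiniteDimensional K R] (N : ℕ),
      (∀ I : Submodule (Env K R) (Env K R), IsSimpleModule (Env K R) (Env K R ⧸ I) →
      N ∣ d * bimodRank K R (Env K R ⧸ I) (RegBimod K R)) → N ∣ d * M) :
    IsField (bimoduleCenter R P) ∧ Module.Finite (bimoduleCenter R P) R ∧
      ∃ r : ℕ, 0 < r ∧ BimoduleIso R (Fin M → P)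
        (Fin r → BalancedTensor (bimoduleCenter R P) R R) := by
  have hf := hP.isField_center h
  refine ⟨hf, ?_⟩
  let Z := bimoduleCenter R P
  let _ : Field Z := hf.toField
  let _ : Algebra Z R := RingHom.toAlgebra' Z.subtype fun z b => hP.mul_comm_of_mem_center z.2 b
  have : IsCentralOver Z R P := ⟨fun z x => z.2 x⟩
  have hK : ∀ z ∈ bimoduleCenter R P, ∃ k : Z, algebraMap Z R k = z := fun z hz => ⟨⟨z, hz⟩, rfl⟩
  have hfin : Module.Finite Z R := hP.finite_center A h Z hK
  refine ⟨hfin, ?_⟩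
  obtain ⟨r, hr, hiso⟩ := hP.bimoduleIso_pi_regBimod Z (hP.mem_coeffSpan A h Z hK) hM (hdvd Z)
  exact ⟨r, hr, hiso.trans ((bimoduleIso_regBimod_balanced Z
    fun z => ⟨hK z, fun ⟨k, hk⟩ => hk ▸ k.2⟩).pi r)⟩

/-- `L` becomes a submodule of the finite module `R` over the field `Z`. The embedding is only
additive, since a factor of a product does not contain the unit. -/
theorem finiteVia_of_injective {Z : Subring R} (hZ : IsField Z) [Module.Finite Z R]
    {L : Type*} [Field L] (ψ : Z →+* L) (f : L →+ R) (hf : Function.Injective f)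
    (h : ∀ z l, f (ψ z * l) = z * f l) : FiniteVia ψ := by
  let _ : Module Z L := Module.compHom L ψ
  have : IsNoetherianRing Z := by
    let _ : Field Z := hZ.toField
    infer_instance
  exact Module.Finite.of_injective ({ f with map_smul' := h } : L →ₗ[Z] R) hf

/-- A homomorphism into a central algebra with central values factors through the base field. -/
theorem exists_ringHom_of_commute {L C Z : Type*} [Field L] [Ring C] [Nontrivial C] [Algebra L C]
    [Algebra.IsCentral L C] [Ring Z] (τ : Z →+* C) (hτ : ∀ z c, τ z * c = c * τ z) :
    ∃ ψ : Z →+* L, ∀ z, algebraMap L C (ψ z) = τ z := by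
  have h1 : ∀ z, ∃ l, algebraMap L C l = τ z := fun z => by
    have h2 : τ z ∈ Subalgebra.center L C := Subalgebra.mem_center_iff.2 fun c => (hτ z c).symm
    rw [Algebra.IsCentral.center_eq_bot] at h2
    exact h2
  choose ψ hψ using h1
  have hi := (algebraMap L C).injective
  exact ⟨{ toFun := ψ
           map_one' := hi (by simp [hψ])
           map_mul' := fun x y => hi (by simp [hψ])
           map_zero' := hi (by simp [hψ])
           map_add' := fun x y => hi (by simp [hψ]) }, hψ⟩

theorem dvd_of_sq_dvd {c a b : ℕ} (h : c ^ 2 ∣ a ^ 2 * b ^ 2) : c ∣ a * b :=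
  (Nat.pow_dvd_pow_iff two_ne_zero).1 (mul_pow a b 2 ▸ h)

end Main

section Simple

theorem eq_bot_or_eq_top_of_mul_mem {C : Type*} [Ring C] [IsSimpleRing C] (V : AddSubgroup C)
    (h : ∀ a c, ∀ v ∈ V, a * v * c ∈ V) : V = ⊥ ∨ V = ⊤ := by
  let J : TwoSidedIdeal C := TwoSidedIdeal.mk' V V.zero_mem V.add_mem V.neg_mem
    (fun {x y} hy => by simpa using h x 1 y hy) (fun {x y} hx => by simpa using h 1 y x hx)
  have hJ : ∀ x, x ∈ J ↔ x ∈ V := fun x => TwoSidedIdeal.mem_mk' _ _ _ _ _ _ x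
  refine (IsSimpleRing.simple.eq_bot_or_eq_top J).imp (fun h => ?_) fun h => ?_
  · refine (AddSubgroup.eq_bot_iff_forall V).2 fun x hx => ?_
    rw [← hJ, h] at hx
    exact hx
  · refine (AddSubgroup.eq_top_iff' V).2 fun x => ?_
    rw [← hJ, h]
    trivial

end Simple

/-! ### Stable ideals in products and connectedness. -/

section Product

variable {ι : Type*} [DecidableEq ι] {B : ι → Type*} [∀ i, Ring (B i)]

theorem single_one_mul (i : ι) (x : ∀ i, B i) : Pi.single i 1 * x = Pi.single i (x i) := by
  rw [← Pi.single_mul_left, one_mul]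

theorem mul_single_one (i : ι) (x : ∀ i, B i) : x * Pi.single i 1 = Pi.single i (x i) := by
  rw [← Pi.single_mul_right, mul_one]

/-- The inclusion of a factor into a product of rings. -/
def singleHom (B : ι → Type*) [∀ i, Ring (B i)] (i : ι) : B i →ₙ+* (∀ i, B i) where
  toFun := Pi.single i
  map_mul' := Pi.single_mul i
  map_zero' := Pi.single_zero i
  map_add' := Pi.single_add i

theorem isFactor_singleHom (i : ι) : IsFactor (singleHom B i) where
  injective := Pi.single_injective i
  comm r := (single_one_mul i r).trans (mul_single_one i r).symm
  surj r := ⟨r i, (single_one_mul i r).symm⟩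

theorem isFactor_id (C : Type*) [Ring C] : IsFactor (NonUnitalRingHom.id C) where
  injective _ _ h := h
  comm r := (one_mul r).trans (mul_one r).symm
  surj r := ⟨r, (one_mul r).symm⟩

/-- With `mem_of_forall_single_mem` this says that a two-sided ideal of a product of simple rings is
the subproduct over the indices whose unit it contains. -/
theorem apply_eq_zero_of_single_not_mem [∀ i, IsSimpleRing (B i)] {V : AddSubgroup (∀ i, B i)}
    (hV : ∀ a c, ∀ v ∈ V, a * v * c ∈ V) {i : ι} (hi : Pi.single i 1 ∉ V) {v : ∀ i, B i}
    (hv : v ∈ V) : v i = 0 := by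
  have h := eq_bot_or_eq_top_of_mul_mem (V.comap (AddMonoidHom.single B i)) fun a c b hb => by
    have := hV (Pi.single i a) (Pi.single i c) _ hb
    rwa [AddMonoidHom.single_apply, ← Pi.single_mul, ← Pi.single_mul] at this
  rcases h with h | h
  · have h1 : v i ∈ V.comap (AddMonoidHom.single B i) := by
      have := hV (Pi.single i 1) 1 v hv
      rwa [mul_one, single_one_mul] at this
    rw [h] at h1
    exact h1
  · exact absurd (show (1 : B i) ∈ V.comap (AddMonoidHom.single B i) from h ▸ trivial) hi

theorem mem_of_forall_single_mem [Fintype ι] {V : AddSubgroup (∀ i, B i)}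
    (hV : ∀ a c, ∀ v ∈ V, a * v * c ∈ V) {v : ∀ i, B i}
    (hv : ∀ i, v i ≠ 0 → Pi.single i 1 ∈ V) : v ∈ V := by
  rw [← Finset.univ_sum_single v]
  refine AddSubgroup.sum_mem _ fun i _ => ?_
  by_cases h : v i = 0
  · rw [h, Pi.single_zero]
    exact V.zero_mem
  · have := hV 1 v _ (hv i h)
    rwa [one_mul, single_one_mul] at this

variable [Fintype ι] [∀ i, IsSimpleRing (B i)]
variable {P : Type*} [AddCommGroup P] [Module (∀ i, B i) P] [Module (∀ i, B i)ᵐᵒᵖ P]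
  [SMulCommClass (∀ i, B i) (∀ i, B i)ᵐᵒᵖ P] {d : ℕ}

/-- Stability puts the coordinates of `PV` in `V`, which kills e_j P e_i. The opposite component
vanishes by `IsGalois.op_smul_eq_of_smul_eq`, applied to the sum `g` of the units outside `V`. -/
theorem IsGalois.component_eq_zero [IsArtinianRing (∀ i, B i)] (hP : IsGalois (∀ i, B i) P d)
    {V : AddSubgroup (∀ i, B i)} (hV : IsCoeffStable (∀ i, B i) P V) {i j : ι}
    (hi : Pi.single i 1 ∈ V) (hj : Pi.single j 1 ∉ V) (x : P) :
    (Pi.single j 1 : ∀ i, B i) • op (Pi.single i 1 : ∀ i, B i) • x = 0 ∧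
      (Pi.single i 1 : ∀ i, B i) • op (Pi.single j 1 : ∀ i, B i) • x = 0 := by
  classical
  obtain ⟨e⟩ := hP.free_left
  have key : ∀ (v g : ∀ i, B i), v ∈ V → (∀ k, Pi.single k 1 ∈ V → g k = 0) → ∀ p : P,
      g • op v • p = 0 := fun v g hv hg p => by
    apply e.injective
    rw [map_zero, map_smul]
    ext n k
    have h1 : e (op v • p) n ∈ V := hV.coeff_mem (LinearMap.proj n ∘ₗ e.toLinearMap) p v hv
    change g k * e (op v • p) n k = 0
    by_cases hk : Pi.single k 1 ∈ V
    · rw [hg k hk, zero_mul]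
    · rw [apply_eq_zero_of_single_not_mem hV.mul_mem hk h1, mul_zero]
  refine ⟨key _ _ hi (fun k hk => ?_) x, ?_⟩
  · have hkj : k ≠ j := by
      rintro rfl
      exact hj hk
    exact Pi.single_eq_of_ne hkj _
  let g : ∀ i, B i := fun k => if Pi.single k 1 ∈ V then 0 else 1
  have hgg : g * g = g := by
    ext k
    by_cases hk : Pi.single k 1 ∈ V <;> simp [g, hk]
  have hgc : ∀ r, g * r = r * g := fun r => by
    ext k
    by_cases hk : Pi.single k 1 ∈ V <;> simp [g, hk]
  have hg : ∀ p : P, g • p = g • op g • p := fun p => by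
    have h1 := key (1 - g) g (mem_of_forall_single_mem hV.mul_mem fun k hk => by
      by_contra h
      simp [g, h] at hk) (fun k hk => by simp [g, hk]) p
    rw [op_sub, op_one, sub_smul, one_smul, smul_sub, sub_eq_zero] at h1
    exact h1
  have h2 := hP.op_smul_eq_of_smul_eq hgg hgc hg (op (Pi.single j 1 : ∀ i, B i) • x)
  have h3 : (Pi.single j 1 : ∀ i, B i) * g = Pi.single j 1 := by
    rw [single_one_mul]
    simp [g, hj]
  have h4 : (Pi.single i 1 : ∀ i, B i) * g = 0 := by
    rw [single_one_mul]
    simp [g, hi]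
  rw [smul_smul, ← op_mul, h3] at h2
  rw [h2, smul_smul, h4, zero_smul]

/-- Membership of the units in `V` is constant along edges in either orientation, so by
connectedness `V` contains all of them or none. -/
theorem IsGalois.eq_bot_or_eq_top_of_connected [IsArtinianRing (∀ i, B i)]
    (hP : IsGalois (∀ i, B i) P d) (hc : IsConnectedBimodule B P)
    (V : AddSubgroup (∀ i, B i)) (hV : IsCoeffStable (∀ i, B i) P V) : V = ⊥ ∨ V = ⊤ := by
  have hstep : ∀ i j, (incidenceGraph B P).Adj i j →
      ((Pi.single i 1 : ∀ i, B i) ∈ V ↔ (Pi.single j 1 : ∀ i, B i) ∈ V) := fun i j hij => by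
    have hz : ¬ ∀ x : P, (Pi.single j 1 : ∀ i, B i) • op (Pi.single i 1 : ∀ i, B i) • x = 0 :=
      fun h => hij (Set.ext fun p => ⟨fun ⟨x, hx⟩ => hx.trans (h x), fun hp =>
        ⟨0, (Set.mem_singleton_iff.1 hp).trans (h 0).symm⟩⟩)
    refine ⟨fun hi => ?_, fun hj => ?_⟩
    · by_contra hj
      exact hz fun x => (hP.component_eq_zero hV hi hj x).1
    · by_contra hi
      exact hz fun x => (hP.component_eq_zero hV hj hi x).2
  have hall : ∀ i j, (Pi.single i 1 : ∀ i, B i) ∈ V → (Pi.single j 1 : ∀ i, B i) ∈ V :=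
    fun i j => by
    obtain ⟨w⟩ := hc.preconnected i j
    induction w with
    | nil => exact id
    | cons h _ ih =>
      rw [SimpleGraph.fromRel_adj] at h
      exact fun hi => ih (h.2.elim (fun h => (hstep _ _ h).1 hi) fun h => (hstep _ _ h).2 hi)
  by_cases h : ∃ i, (Pi.single i 1 : ∀ i, B i) ∈ V
  · obtain ⟨i, hi⟩ := h
    exact Or.inr ((AddSubgroup.eq_top_iff' V).2 fun v =>
      mem_of_forall_single_mem hV.mul_mem fun j _ => hall i j hi)
  · push Not at h
    exact Or.inl ((AddSubgroup.eq_bot_iff_forall V).2 fun v hv =>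
      funext fun i => apply_eq_zero_of_single_not_mem hV.mul_mem (h i) hv)

theorem finite_pi_of_finite {ι : Type*} [Fintype ι] (L : ι → Type*) [∀ i, Field (L i)]
    (B : ι → Type*) [∀ i, Ring (B i)] [∀ i, Algebra (L i) (B i)]
    [∀ i, FiniteDimensional (L i) (B i)] : Module.Finite (∀ i, L i) (∀ i, B i) := by
  classical
  let b := fun i => Module.finBasis (L i) (B i)
  refine ⟨Finset.univ.image fun p : Σ i, Fin (Module.finrank (L i) (B i)) =>
    Pi.single p.1 (b p.1 p.2), top_le_iff.1 fun x _ => ?_⟩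
  rw [← Finset.univ_sum_single x]
  refine Submodule.sum_mem _ fun i _ => ?_
  have h : Pi.single i (x i) = ∑ k, (Pi.single i ((b i).repr (x i) k) : ∀ i, L i) •
      (Pi.single i (b i k) : ∀ i, B i) := by
    conv_lhs => rw [← (b i).sum_repr (x i)]
    ext j
    rw [Finset.sum_apply]
    by_cases hj : j = i
    · subst hj
      simp
    · simp [Pi.single_eq_of_ne hj]
  rw [h]
  exact Submodule.sum_mem _ fun k _ => Submodule.smul_mem _ _
    (Submodule.subset_span (Finset.mem_coe.2 (Finset.mem_image.2 ⟨⟨i, k⟩, Finset.mem_univ _, rfl⟩)))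

end Product

end GaloisBimodule

/-! ### The theorem. -/

open GaloisBimodule in
theorem mainTheorem8 :
    (∀ {ι : Type*} [Fintype ι] [DecidableEq ι]
        (L : ι → Type*) [∀ i, Field (L i)]
        (B : ι → Type*) [∀ i, Ring (B i)] [∀ i, Algebra (L i) (B i)]
        [∀ i, Algebra.IsCentral (L i) (B i)] [∀ i, IsSimpleRing (B i)]
        [∀ i, FiniteDimensional (L i) (B i)]
        (m : ι → ℕ) (_ : ∀ i, Module.finrank (L i) (B i) = m i ^ 2)
        (P : Type*) [AddCommGroup P] [Module (∀ i, B i) P] [Module (∀ i, B i)ᵐᵒᵖ P]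
        [SMulCommClass (∀ i, B i) (∀ i, B i)ᵐᵒᵖ P]
        (d : ℕ) (_ : IsGalois (∀ i, B i) P d) (_ : IsConnectedBimodule B P),
      IsField (bimoduleCenter (∀ i, B i) P) ∧
      (∃ ψ : ∀ i, bimoduleCenter (∀ i, B i) P →+* L i,
        (∀ i (z : bimoduleCenter (∀ i, B i) P), algebraMap (L i) (B i) (ψ i z) = (z : ∀ i, B i) i) ∧
        ∀ i, FiniteVia (ψ i)) ∧
      ∃ r : ℕ, 0 < r ∧
        BimoduleIso (∀ i, B i) (Fin (Finset.univ.gcd m ^ 2) → P)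
          (Fin r → BalancedTensor (bimoduleCenter (∀ i, B i) P) (∀ i, B i) (∀ i, B i))) ∧
    (∀ (L : Type*) [Field L] (B : Type*) [Ring B] [Algebra L B]
        [Algebra.IsCentral L B] [IsSimpleRing B] [FiniteDimensional L B]
        (m : ℕ) (_ : Module.finrank L B = m ^ 2)
        (P : Type*) [AddCommGroup P] [Module B P] [Module Bᵐᵒᵖ P] [SMulCommClass B Bᵐᵒᵖ P]
        (d : ℕ) (_ : IsGalois B P d),
      IsField (bimoduleCenter B P) ∧
      (∃ ψ : bimoduleCenter B P →+* L,
        (∀ z : bimoduleCenter B P, algebraMap L B (ψ z) = (z : B)) ∧ FiniteVia ψ) ∧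
      ∃ r : ℕ, 0 < r ∧
        BimoduleIso B (Fin (m ^ 2) → P)
          (Fin r → BalancedTensor (bimoduleCenter B P) B B)) := by
  refine ⟨?_, ?_⟩
  · intro ι _ _ L _ B _ _ _ _ _ m hm P _ _ _ _ d hP hc
    have hart : ∀ i, IsArtinianRing (B i) := fun i => isArtinian_of_tower (L i) inferInstance
    have := finite_pi_of_finite L B
    have hne : Nonempty ι := hc.nonempty
    -- An empty gcd would be 0; connectedness supplies an index.
    have hm0 : 0 < Finset.univ.gcd m := Nat.pos_of_ne_zero fun h0 => by
      obtain ⟨i⟩ := hne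
      have h1 : 0 < Module.finrank (L i) (B i) := Module.finrank_pos
      rw [hm, Finset.gcd_eq_zero_iff.1 h0 i (Finset.mem_univ i)] at h1
      exact lt_irrefl _ h1
    have hnt : Nontrivial (∀ i, B i) := (isFactor_singleHom (B := B) hne.some).injective.nontrivial
    obtain ⟨hf, hfin, hr⟩ := hP.isField_and_bimoduleIso (∀ i, L i)
      (hP.eq_bot_or_eq_top_of_connected hc) (pow_pos hm0 2) fun K _ _ _ N hN => by
        -- Each pair of factors supports a simple bimodule, so N divides every d m_i m_j; gcds over
        -- j and then over i give d m_*².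
        have h1 : ∀ i j, N ∣ d * (m i * m j) := fun i j => by
          obtain ⟨I, hI, hdvd⟩ := (isFactor_singleHom (B := B) i).exists_dvd K (L i) (L j)
            (isFactor_singleHom (B := B) j)
          rw [hm, hm] at hdvd
          exact (hN I hI).trans (mul_dvd_mul_left d (dvd_of_sq_dvd hdvd))
        have h2 : ∀ i, N ∣ d * m i * Finset.univ.gcd m := fun i => by
          have := Finset.dvd_gcd fun j (_ : j ∈ Finset.univ) => (mul_assoc d (m i) (m j)) ▸ h1 i j
          rwa [Finset.gcd_mul_left, normalize_eq] at this
        have h3 := Finset.dvd_gcd fun i (_ : i ∈ Finset.univ) =>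
          (mul_right_comm d (m i) (Finset.univ.gcd m)) ▸ h2 i
        rwa [Finset.gcd_mul_left, normalize_eq, mul_assoc, ← sq] at h3
    refine ⟨hf, ?_, hr⟩
    have hψ := fun i => exists_ringHom_of_commute (L := L i)
      ((Pi.evalRingHom B i).comp (bimoduleCenter (∀ i, B i) P).subtype) fun z c => by
        have := congrFun (hP.mul_comm_of_mem_center z.2 (Pi.single i c)) i
        simpa using this
    choose ψ hψ using hψ
    refine ⟨ψ, hψ, fun i => finiteVia_of_injective hf (ψ i)
      ((AddMonoidHom.single B i).comp (algebraMap (L i) (B i)).toAddMonoidHom)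
      ((Pi.single_injective i).comp (algebraMap (L i) (B i)).injective) fun z l => ?_⟩
    change Pi.single i (algebraMap (L i) (B i) (ψ i z * l)) =
      (z : ∀ i, B i) * Pi.single i (algebraMap (L i) (B i) l)
    rw [map_mul, hψ, ← Pi.single_mul_right]
    rfl
  · intro L _ B _ _ _ _ _ m hm P _ _ _ _ d hP
    have : IsArtinianRing B := isArtinian_of_tower L inferInstance
    have hm0 : 0 < m ^ 2 := hm ▸ Module.finrank_pos
    -- A simple ring has no proper nonzero two-sided ideals, so no connectedness is needed, and the
    -- only pair of factors is `B` with itself.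
    obtain ⟨hf, hfin, hr⟩ := hP.isField_and_bimoduleIso L
      (fun V hV => eq_bot_or_eq_top_of_mul_mem V hV.mul_mem) hm0 fun K _ _ _ N hN => by
        obtain ⟨I, hI, hdvd⟩ := (isFactor_id B).exists_dvd K L L (isFactor_id B)
        rw [hm] at hdvd
        exact (hN I hI).trans (mul_dvd_mul_left d (sq m ▸ dvd_of_sq_dvd hdvd))
    refine ⟨hf, ?_, hr⟩
    obtain ⟨ψ, hψ⟩ := exists_ringHom_of_commute (L := L) (bimoduleCenter B P).subtype
      fun z c => hP.mul_comm_of_mem_center z.2 c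
    exact ⟨ψ, hψ, finiteVia_of_injective hf ψ (algebraMap L B).toAddMonoidHom
      (algebraMap L B).injective fun z l => by
        change algebraMap L B (ψ z * l) = (z : B) * algebraMap L B l
        rw [map_mul, hψ]
        rfl⟩
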